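/- Let $E$ be a finite-dimensional real normed vector space, $Q\subseteq E$ open, $TQ=Q\times E$, and let $L:TQ\to\mathbb R$ be a regular Lagrangian, i.e. $L$ is $C^\infty$ and $\partial^2L/\partial v^2$ is nonsingular at every point of $TQ$. The Euler--Lagrange equation then reads $\ddot q=f(q,\dot q)$; let $q^{(k)}(q,v)$ be the $k$-th time derivative of its solutions expressed by $(q,v)$, that is $q^{(0)}(q,v)=q$, $q^{(k+1)}(q,v)=Dq^{(k)}(q,v)\cdot(v,f(q,v))$, and let the Taylor method of order $s$ be $$\Psi^{(s)}_h(q,v)=\Bigl(\sum_{k=0}^{s}\tfrac{h^k}{k!}q^{(k)}(q,v),\ \sum_{k=1}^{s+1}\tfrac{h^{k-1}}{(k-1)!}q^{(k)}(q,v)\Bigr),$$ with $\pi_Q$ and $\pi_V$ the projections to the first and second component. Let $r$ be odd, and let $(b_i,c_i)_{i=1}^m$ be a quadrature rule on $[0,1]$ that is symmetric ($c_i=1-c_{m-i+1}$, $b_i=b_{m-i+1}$) and of order $r+1$ (exact for polynomials of degree at most $r$). For $q_0,q_1$ and $h\neq0$ let $\tilde v_0,\tilde v_1$ solve $$q_1=\pi_Q\Psi^{(r)}_h(q_0,\tilde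 v_0),\qquad q_0=\pi_Q\Psi^{(r)}_{-h}(q_1,\tilde v_1)$$ (if there are several solutions, the one closest to $(q_1-q_0)/h$ is taken), put $$q_{c_i}=c_i\,\pi_Q\Psi^{(r)}_{c_ih}(q_0,\tilde v_0)+(1-c_i)\,\pi_Q\Psi^{(r)}_{-(1-c_i)h}(q_1,\tilde v_1),$$ $$v_{c_i}=c_i\,\pi_V\Psi^{(r-1)}_{c_ih}(q_0,\tilde v_0)+(1-c_i)\,\pi_V\Psi^{(r-1)}_{-(1-c_i)h}(q_1,\tilde v_1),$$ except that $(q_{c_i},v_{c_i})$ is $(q_0,\tilde v_0)$ if $c_i=0$ and $(q_1,\tilde v_1)$ if $c_i=1$, and let $$L_d(q_0,q_1;h)=h\sum_{i=1}^m b_iL(q_{c_i},v_{c_i}).$$ The symmetric Taylor variational integrator $(q_0,p_0)\mapsto(q_1,p_1)$ is defined implicitly by $p_0=-D_1L_d(q_0,q_1;h)$, $p_1=D_2L_d(q_0,q_1;h)$. Then this integrator is well defined and of order $r+1$. Precisely, for every compact $K\subset TQ$: (1) There are $\rho,h_0>0$ such that for $0<|h|<h_0$ and $(q_0,w)\in K$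 the equation $q_0+hw=\pi_Q\Psi^{(r)}_h(q_0,v)$ has exactly one solution $v$ with $\|v-w\|<\rho$, and it is the closest solution to $w$, i.e. the $\tilde v_0$ belonging to $q_0$, $q_1=q_0+hw$. (2) There are $\rho,h_0>0$ and $C$ such that for $0<|h|<h_0$ and $(q_0,v_0)\in K$, with $p_0=\frac{\partial L}{\partial v}(q_0,v_0)$: there is exactly one $(q_1,p_1)$ with $\|(q_1-q_0)/h-v_0\|<\rho$ such that $L_d(\cdot,\cdot;h)$ is differentiable at $(q_0,q_1)$, $p_0=-D_1L_d(q_0,q_1;h)$ and $p_1=D_2L_d(q_0,q_1;h)$; the solution $q(t)$ of the Euler--Lagrange equation with $q(0)=q_0$, $\dot q(0)=v_0$ exists between $0$ and $h$; and $$\|q_1-q(h)\|\le C|h|^{r+2},\qquad \bigl\|p_1-\tfrac{\partial L}{\partial v}(q(h),\dot q(h))\bigr\|\le C|h|^{r+2}.$$ -/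

import Mathlib

open scoped ContDiff

noncomputable section

namespace TaylorVI

variable {E : Type*} [NormedAddCommGroup E] [NormedSpace ℝ E]

/-! Configuration space: an open set `Q` of a finite-dimensional real vector space `E`.
Its tangent bundle is `Q × E`; a Lagrangian is a function `L (q, v)` on it. -/

/-- `∂L/∂q (q, v)`, a covector. -/
def partialQ (L : E × E → ℝ) (x : E × E) : E →L[ℝ] ℝ :=
  fderiv ℝ (fun q => L (q, x.2)) x.1

/-- The momentum `∂L/∂v (q, v)`, a covector (the fibre derivative of `L`). -/
def momentum (L : E × E → ℝ) (x : E × E) : E →L[ℝ] ℝ :=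
  fderiv ℝ (fun v => L (x.1, v)) x.2

/-- The fibre Hessian `∂²L/∂v² (q, v)`, as a linear map from vectors to covectors. -/
def hessV (L : E × E → ℝ) (x : E × E) : E →L[ℝ] (E →L[ℝ] ℝ) :=
  fderiv ℝ (fun v => momentum L (x.1, v)) x.2

/-- The mixed second derivative: `mixedQV L (q, v) w` is the derivative of `∂L/∂v` when `q` moves
in the direction `w`. -/
def mixedQV (L : E × E → ℝ) (x : E × E) : E →L[ℝ] (E →L[ℝ] ℝ) :=
  fderiv ℝ (fun q => momentum L (q, x.2)) x.1

/-- A smooth Lagrangian on `Q × E` is regular if its fibre Hessian is everywhere nonsingular. -/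
structure IsRegularLagrangian (Q : Set E) (L : E × E → ℝ) : Prop where
  smooth : ContDiffOn ℝ ∞ L (Q ×ˢ Set.univ)
  nonsingular : ∀ x ∈ Q ×ˢ (Set.univ : Set E), (hessV L x).IsInvertible

/-- The pair `(q, v)` is a solution of the Euler--Lagrange equation
`d/dt (∂L/∂v (q, q')) = ∂L/∂q (q, q')`, `v = q'`, in `Q` on the time interval `I`. -/
structure IsELSolution (Q : Set E) (L : E × E → ℝ) (I : Set ℝ) (q v : ℝ → E) : Prop where
  mem : ∀ t ∈ I, q t ∈ Q
  velocity : ∀ t ∈ I, HasDerivWithinAt q (v t) I t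
  velocity_continuous : ContinuousOn v I
  eulerLagrange : ∀ t ∈ I,
    HasDerivWithinAt (fun s => momentum L (q s, v s)) (partialQ L (q t, v t)) I t

/-- The acceleration `q''` as a function of `(q, q')`: the Euler--Lagrange equation of a regular
Lagrangian solved for the second derivative,
`f (q, v) = (∂²L/∂v²)⁻¹ (∂L/∂q - (∂²L/∂q∂v) v)`. -/
def accel (L : E × E → ℝ) (x : E × E) : E :=
  (hessV L x).inverse (partialQ L x - mixedQV L x x.2)

/-- The time derivative `q^(k)` of a solution of the Euler--Lagrange equation as a function of
`(q, q')`, by prolongation: differentiate repeatedly along the vector field `(q, v) ↦ (v, f (q, v))`. -/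
def prolong (L : E × E → ℝ) : ℕ → E × E → E
  | 0 => fun x => x.1
  | k + 1 => fun x => fderiv ℝ (prolong L k) x (x.2, accel L x)

/-- The Taylor method `Ψ^(s)_h` of order `s` for the Euler--Lagrange vector field on `Q × E`:
`(∑_{k=0}^{s} h^k/k! q^(k), ∑_{k=1}^{s+1} h^(k-1)/(k-1)! q^(k))`. -/
def taylorMap (L : E × E → ℝ) (s : ℕ) (h : ℝ) (x : E × E) : E × E :=
  (∑ k ∈ Finset.range (s + 1), (h ^ k / (k.factorial : ℝ)) • prolong L k x,
   ∑ k ∈ Finset.range (s + 1), (h ^ k / (k.factorial : ℝ)) • prolong L (k + 1) x)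

/-- The inverse problem `q₁ = π_Q Ψ^(r)_h (q₀, v)` for the initial velocity `v`. -/
def SolvesInverse (L : E × E → ℝ) (r : ℕ) (h : ℝ) (q₀ q₁ v : E) : Prop :=
  (taylorMap L r h (q₀, v)).1 = q₁

/-- The initial velocity determined by the inverse problem. Where the (nonlinear) equation has
several solutions, the one closest to the difference quotient `(q₁ - q₀) / h` is meant. -/
def initVel (L : E × E → ℝ) (r : ℕ) (h : ℝ) (q₀ q₁ : E) : E :=
  Classical.epsilon fun v => SolvesInverse L r h q₀ q₁ v ∧
    ∀ v', SolvesInverse L r h q₀ q₁ v' →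
      ‖v - h⁻¹ • (q₁ - q₀)‖ ≤ ‖v' - h⁻¹ • (q₁ - q₀)‖

/-- The approximation `(q_c, v_c)` at the quadrature node `c`: with `ṽ₀` and `ṽ₁` the solutions of
`q₁ = π_Q Ψ^(r)_h (q₀, ṽ₀)` and `q₀ = π_Q Ψ^(r)_{-h} (q₁, ṽ₁)`, combine the Taylor approximations
started at both ends; at the end nodes themselves use `(q₀, ṽ₀)` and `(q₁, ṽ₁)`. -/
def nodeValue (L : E × E → ℝ) (r : ℕ) (h : ℝ) (q₀ q₁ : E) (c : ℝ) : E × E :=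
  let v₀ := initVel L r h q₀ q₁
  let v₁ := initVel L r (-h) q₁ q₀
  if c = 0 then (q₀, v₀)
  else if c = 1 then (q₁, v₁)
  else
    (c • (taylorMap L r (c * h) (q₀, v₀)).1
        + (1 - c) • (taylorMap L r (-((1 - c) * h)) (q₁, v₁)).1,
     c • (taylorMap L (r - 1) (c * h) (q₀, v₀)).2
        + (1 - c) • (taylorMap L (r - 1) (-((1 - c) * h)) (q₁, v₁)).2)

/-- The discrete Lagrangian of the symmetric Taylor variational integrator,
`L_d (q₀, q₁; h) = h ∑ᵢ bᵢ L (q_{cᵢ}, v_{cᵢ})`. -/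
def discreteLagrangian (L : E × E → ℝ) (r : ℕ) {m : ℕ} (b c : Fin m → ℝ)
    (h : ℝ) (q₀ q₁ : E) : ℝ :=
  h * ∑ i, b i * L (nodeValue L r h q₀ q₁ (c i))

/-- A quadrature rule on `[0, 1]` with weights `b` and nodes `c` has order (at least) `s` if it
integrates every polynomial of degree less than `s` exactly. -/
def QuadratureOrder {m : ℕ} (b c : Fin m → ℝ) (s : ℕ) : Prop :=
  ∀ k < s, ∑ i, b i * c i ^ k = ∫ t in (0 : ℝ)..1, t ^ k

/-- A quadrature rule is symmetric if `cᵢ = 1 - c_{m-i+1}` and `bᵢ = b_{m-i+1}`. -/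
def QuadratureSymmetric {m : ℕ} (b c : Fin m → ℝ) : Prop :=
  ∀ i, c i = 1 - c i.rev ∧ b i = b i.rev

/-- One step `(q₀, p₀) ↦ (q₁, p₁)` of the variational integrator of a discrete Lagrangian `Ld` with
step size `h`: `p₀ = -D₁ Ld (q₀, q₁; h)`, `p₁ = D₂ Ld (q₀, q₁; h)`. -/
def IsStep (Ld : ℝ → E → E → ℝ) (h : ℝ) (y₀ y₁ : E × (E →L[ℝ] ℝ)) : Prop :=
  DifferentiableAt ℝ (fun z : E × E => Ld h z.1 z.2) (y₀.1, y₁.1) ∧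
  y₀.2 = -fderiv ℝ (fun q => Ld h q y₁.1) y₀.1 ∧
  y₁.2 = fderiv ℝ (fun q => Ld h y₀.1 q) y₁.1

/-- For all small nonzero `h`, locally uniformly on the tangent bundle, `initVel` is the unique
solution near `w = (q₁ - q₀) / h` of the inverse problem with data `q₀`, `q₁ = q₀ + h w`. -/
def InverseWellPosed (Q : Set E) (L : E × E → ℝ) (r : ℕ) : Prop :=
  ∀ K : Set (E × E), IsCompact K → K ⊆ Q ×ˢ Set.univ →
    ∃ ρ > (0 : ℝ), ∃ h₀ > (0 : ℝ), ∀ h : ℝ, 0 < |h| → |h| < h₀ → ∀ x ∈ K, ∀ v : E,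
      (‖v - x.2‖ < ρ ∧ SolvesInverse L r h x.1 (x.1 + h • x.2) v) ↔
        v = initVel L r h x.1 (x.1 + h • x.2)

/-- The variational integrator of `Ld` is a well-defined one-step method of order `p` for the
Lagrangian `L`. For every compact set `K` of initial data `(q₀, v₀)`, all sufficiently small nonzero
step sizes `h`, and `p₀ = ∂L/∂v (q₀, v₀)`: there is exactly one step `(q₀, p₀) ↦ (q₁, p₁)` for which
`(q₁ - q₀) / h` is near `v₀`; the exact solution starting at `(q₀, v₀)` exists up to time `h`; and
`(q₁, p₁)` differs from the exact position and momentum at time `h` by at most `C |h|^(p+1)`. -/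
def IntegratorHasOrder (Q : Set E) (L : E × E → ℝ) (Ld : ℝ → E → E → ℝ) (p : ℕ) : Prop :=
  ∀ K : Set (E × E), IsCompact K → K ⊆ Q ×ˢ Set.univ →
    ∃ ρ > (0 : ℝ), ∃ h₀ > (0 : ℝ), ∃ C : ℝ, ∀ h : ℝ, 0 < |h| → |h| < h₀ → ∀ x ∈ K,
      (∃! y : E × (E →L[ℝ] ℝ),
        ‖h⁻¹ • (y.1 - x.1) - x.2‖ < ρ ∧ IsStep Ld h (x.1, momentum L x) y) ∧
      (∃ q v : ℝ → E, IsELSolution Q L (Set.uIcc 0 h) q v ∧ q 0 = x.1 ∧ v 0 = x.2) ∧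
      ∀ y : E × (E →L[ℝ] ℝ),
        ‖h⁻¹ • (y.1 - x.1) - x.2‖ < ρ → IsStep Ld h (x.1, momentum L x) y →
        ∀ q v : ℝ → E, IsELSolution Q L (Set.uIcc 0 h) q v → q 0 = x.1 → v 0 = x.2 →
          ‖y.1 - q h‖ ≤ C * |h| ^ (p + 1) ∧
          ‖y.2 - momentum L (q h, v h)‖ ≤ C * |h| ^ (p + 1)

end TaylorVI

end

/-!
The discrete Lagrangian is only defined for `h ≠ 0`, and the step and inverse problems degenerate
as `h → 0`. In the variables `((q, w), h)`, where the end points are `q₀ = q` and `q₁ = q + h w`,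
both difficulties disappear: the inverse problem divided by `h` reads `w = v + O(h)`, so that its
solution `V` is smooth across `h = 0` (`exists_isInverseVel`, by the implicit function theorem in
the form `exists_velocity_inverse`), and `ℓ ((q, w), h) = L_d (q, q + h w; h) / h` is a smooth
function with `ℓ ((q, w), 0) = L (q, w)` (`scaledLagrangian`). The step equation becomes
`∂ℓ/∂w - h ∂ℓ/∂q = ∂L/∂v (q, v)`, which at `h = 0` is the Legendre transformation and hence is
uniquely solvable near `w = v` for small `h` (`exists_step`). All estimates are local at a point
`(x₀, 0)`, and compactness makes the constants uniform (`exists_uniform_of_compact`).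

In the lemmas the odd order of the Taylor method is written `r + 1`, so that the integrator has
order `r + 2` and local error `O(h^(r+3))`.

The exact solution enters only through Taylor's theorem along integral curves
(`exists_taylor_along_curve`); a flow that is merely continuous suffices. Everything that has to
be differentiated is expressed by truncated Lie series, which are smooth by construction. Let `Γ`
be the Taylor method of order `r + 2` and let `h W` be its displacement. Evaluated at
`((q, W), h)`, the velocities from the inverse problem and therefore all node values are accurate
to `O(h^(r+1))`, and so `ℓ` differs from the Taylor mean `h⁻¹ ∫ L` along the solution by
`f = O(h^(r+1))`. Because the rule is symmetric, `ℓ` is invariant under the exchange of the end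
points together with `h ↦ -h`; thus `f (Γ (x, h), -h) = f (x, h) + O(h^(r+2))`. As `r + 1` is odd,
the coefficient of `h^(r+1)` in `f` must vanish, which gives `f = O(h^(r+2))`
(`isBigO_succ_of_symmetric`, `scaledLagrangian_accuracy`).

For smooth functions a bound `O(h^n)`, uniform in the initial data, may be differentiated in the
initial data (`isBigO_derivX`). Comparing the derivative of the discrete action with the first
variation formula, in which the derivative of the action is the boundary term `∂L/∂v dq`
(`RegularAt.derivX_action`), shows that the discrete momenta along `Γ` agree with those of the
exact solution: `∂ℓ/∂w` to `O(h^(r+2))` and the increment `h ∂ℓ/∂q` to `O(h^(r+3))`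
(`momenta_accuracy`). Hence `W` solves the step equation up to `O(h^(r+2))`, the solution `w` of
the step equation is `W + O(h^(r+2))`, and the position `q + h w` is accurate to `O(h^(r+3))`. For
the momentum, `p₁ = p₀ + h ∂ℓ/∂q` retains the factor `h` and gives the same order.

The exact solutions of the Euler--Lagrange equation are the integral curves of the vector field
`(v, f (q, v))`, since the velocity of a solution is differentiable by the local invertibility of
the Legendre transformation (`IsELSolution.hasDerivWithinAt`), and they are unique by Grönwall's
inequality (`eq_of_hasDerivWithinAt`).
-/

open Filter Topology Asymptotics

noncomputable section

namespace TaylorVI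

/-! ### Lie series of a vector field -/

section LieSeries

variable {F : Type*} [NormedAddCommGroup F] [NormedSpace ℝ F]
  {G : Type*} [NormedAddCommGroup G] [NormedSpace ℝ G]

/-- The `k`-th iterated Lie derivative of `φ` along the vector field `X`. -/
def lieIter (X : F → F) (φ : F → G) : ℕ → F → G
  | 0 => φ
  | k + 1 => fun x => fderiv ℝ (lieIter X φ k) x (X x)

/-- The Lie series `∑_{k<n} h^k/k! D_X^k φ`, truncated to `n` terms: the Taylor polynomial in `h`
of `φ` along the flow of `X`. -/
def lieTaylor (X : F → F) (φ : F → G) (n : ℕ) (h : ℝ) (x : F) : G :=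
  ∑ k ∈ Finset.range n, (h ^ k / (k.factorial : ℝ)) • lieIter X φ k x

/-- The truncated series `∑_{k<n} h^k/(k+1)! D_X^k φ`: the Taylor polynomial in `h` of the mean
value `h⁻¹ ∫_0^h φ` of `φ` along the flow of `X`. -/
def lieMean (X : F → F) (φ : F → G) (n : ℕ) (h : ℝ) (x : F) : G :=
  ∑ k ∈ Finset.range n, (h ^ k / ((k + 1).factorial : ℝ)) • lieIter X φ k x

lemma lieIter_succ' (X : F → F) (φ : F → G) (k : ℕ) :
    lieIter X φ (k + 1) = lieIter X (lieIter X φ 1) k := by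
  induction k with
  | zero => rfl
  | succ k ih =>
    funext x
    change fderiv ℝ (lieIter X φ (k + 1)) x (X x) = _
    rw [ih]; rfl

lemma hasDerivAt_pow_div_factorial (k : ℕ) (h : ℝ) :
    HasDerivAt (fun h : ℝ => h ^ (k + 1) / ((k + 1).factorial : ℝ)) (h ^ k / (k.factorial : ℝ))
      h := by
  have h1 := (hasDerivAt_pow (k + 1) h).div_const ((k + 1).factorial : ℝ)
  refine h1.congr_deriv ?_
  have : (k.factorial : ℝ) ≠ 0 := by positivity
  rw [Nat.factorial_succ]
  push_cast
  field_simp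

lemma hasDerivAt_lieTaylor (X : F → F) (φ : F → G) (n : ℕ) (h : ℝ) (x : F) :
    HasDerivAt (fun h => lieTaylor X φ (n + 1) h x) (lieTaylor X (lieIter X φ 1) n h x) h := by
  simp only [lieTaylor, Finset.sum_range_succ']
  simp only [← lieIter_succ', pow_zero]
  exact (HasDerivAt.fun_sum fun k _ =>
    (hasDerivAt_pow_div_factorial k h).smul_const (lieIter X φ (k + 1) x)).add_const _

lemma hasDerivAt_smul_lieMean (X : F → F) (φ : F → G) (n : ℕ) (h : ℝ) (x : F) :
    HasDerivAt (fun h => h • lieMean X φ n h x) (lieTaylor X φ n h x) h := by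
  have : (fun h : ℝ => h • lieMean X φ n h x) = fun h : ℝ =>
      ∑ k ∈ Finset.range n, (h ^ (k + 1) / ((k + 1).factorial : ℝ)) • lieIter X φ k x := by
    funext h
    rw [lieMean, Finset.smul_sum]
    refine Finset.sum_congr rfl fun k _ => ?_
    rw [smul_smul]; congr 1; ring
  rw [this]
  exact HasDerivAt.fun_sum fun k _ =>
    (hasDerivAt_pow_div_factorial k h).smul_const (lieIter X φ k x)

lemma lieTaylor_succ_eq (X : F → F) (φ : F → G) (n : ℕ) (h : ℝ) (x : F) :
    lieTaylor X φ (n + 1) h x = φ x + h • lieMean X (lieIter X φ 1) n h x := by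
  simp only [lieTaylor, lieMean, Finset.sum_range_succ', Finset.smul_sum, ← lieIter_succ']
  rw [add_comm]
  congr 1
  · simp [lieIter]
  · refine Finset.sum_congr rfl fun k _ => ?_
    rw [smul_smul]; congr 1; ring

lemma lieTaylor_zero_right (X : F → F) (φ : F → G) (n : ℕ) (x : F) :
    lieTaylor X φ (n + 1) 0 x = φ x := by
  simp [lieTaylor_succ_eq]

lemma lieMean_zero_right (X : F → F) (φ : F → G) (n : ℕ) (x : F) :
    lieMean X φ (n + 1) 0 x = φ x := by
  simp [lieMean, Finset.sum_range_succ', lieIter]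

lemma contDiffAt_lieIter {X : F → F} {φ : F → G} {x₀ : F} (hX : ContDiffAt ℝ ∞ X x₀)
    (hφ : ContDiffAt ℝ ∞ φ x₀) (k : ℕ) : ContDiffAt ℝ ∞ (lieIter X φ k) x₀ := by
  induction k with
  | zero => exact hφ
  | succ k ih => exact (ih.fderiv_right (m := ∞) (by simp)).clm_apply hX

lemma contDiffAt_lieTaylor {X : F → F} {φ : F → G} {x₀ : F} (hX : ContDiffAt ℝ ∞ X x₀)
    (hφ : ContDiffAt ℝ ∞ φ x₀) (n : ℕ) (h : ℝ) :
    ContDiffAt ℝ ∞ (fun p : F × ℝ => lieTaylor X φ n p.2 p.1) (x₀, h) := by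
  refine ContDiffAt.sum fun k _ => ?_
  exact ((contDiffAt_snd.pow k).div_const _).smul
    ((contDiffAt_lieIter hX hφ k).comp (x₀, h) contDiffAt_fst)

lemma contDiffAt_lieMean {X : F → F} {φ : F → G} {x₀ : F} (hX : ContDiffAt ℝ ∞ X x₀)
    (hφ : ContDiffAt ℝ ∞ φ x₀) (n : ℕ) (h : ℝ) :
    ContDiffAt ℝ ∞ (fun p : F × ℝ => lieMean X φ n p.2 p.1) (x₀, h) := by
  refine ContDiffAt.sum fun k _ => ?_
  exact ((contDiffAt_snd.pow k).div_const _).smul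
    ((contDiffAt_lieIter hX hφ k).comp (x₀, h) contDiffAt_fst)

lemma eventually_differentiableAt {φ : F → G} {x₀ : F} (hφ : ContDiffAt ℝ ∞ φ x₀) :
    ∀ᶠ x in 𝓝 x₀, DifferentiableAt ℝ φ x := by
  have h1 : ContDiffAt ℝ 1 φ x₀ := hφ.of_le (by exact_mod_cast le_top)
  exact (h1.eventually (by simp)).mono fun x hx => hx.differentiableAt (by simp)

/-- Taylor's theorem along integral curves of `X`, with a bound that is uniform in the curve. The
induction passes to the Lie derivative of `φ`, whose defect is the time derivative of that of `φ`.
-/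
lemma exists_taylor_along_curve {X : F → F} {x₀ : F} (hX : ContDiffAt ℝ ∞ X x₀) (n : ℕ) :
    ∀ {φ : F → G}, ContDiffAt ℝ ∞ φ x₀ → ∃ B ∈ 𝓝 x₀, ∃ M : ℝ, ∀ (γ : ℝ → F) (s t : ℝ),
      (∀ τ ∈ Set.uIcc s t, γ τ ∈ B ∧ HasDerivAt γ (X (γ τ)) τ) →
      ‖φ (γ t) - lieTaylor X φ n (t - s) (γ s)‖ ≤ M * |t - s| ^ n := by
  induction n with
  | zero =>
    intro φ hφ
    have h1 : ∀ᶠ x in 𝓝 x₀, ‖φ x‖ < ‖φ x₀‖ + 1 :=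
      hφ.continuousAt.norm.eventually_lt_const (lt_add_one _)
    refine ⟨_, h1, ‖φ x₀‖ + 1, fun γ s t h => ?_⟩
    have := (h t Set.right_mem_uIcc).1
    simpa [lieTaylor] using this.le
  | succ n ih =>
    intro φ hφ
    obtain ⟨B, hB, M, hM⟩ := ih (contDiffAt_lieIter hX hφ 1)
    refine ⟨B ∩ {x | DifferentiableAt ℝ φ x},
      inter_mem hB (eventually_differentiableAt hφ), M, fun γ s t h => ?_⟩
    have hstep : ∀ τ ∈ Set.uIcc s t,
        ‖lieIter X φ 1 (γ τ) - lieTaylor X (lieIter X φ 1) n (τ - s) (γ s)‖ ≤ M * |τ - s| ^ n :=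
      fun τ hτ => hM γ s τ fun σ hσ =>
        ⟨(h σ (Set.uIcc_subset_uIcc_left hτ hσ)).1.1, (h σ (Set.uIcc_subset_uIcc_left hτ hσ)).2⟩
    have hderiv : ∀ τ ∈ Set.uIcc s t, HasDerivWithinAt
        (fun τ => φ (γ τ) - lieTaylor X φ (n + 1) (τ - s) (γ s))
        (lieIter X φ 1 (γ τ) - lieTaylor X (lieIter X φ 1) n (τ - s) (γ s)) (Set.uIcc s t) τ := by
      intro τ hτ
      have h1 := (h τ hτ).1.2.hasFDerivAt.comp_hasDerivAt τ (h τ hτ).2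
      have h2 := (hasDerivAt_lieTaylor X φ n (τ - s) (γ s)).comp_sub_const τ s
      exact (h1.sub h2).hasDerivWithinAt
    have hbound : ∀ τ ∈ Set.uIcc s t,
        ‖lieIter X φ 1 (γ τ) - lieTaylor X (lieIter X φ 1) n (τ - s) (γ s)‖
          ≤ M * |t - s| ^ n := by
      intro τ hτ
      have habs : |τ - s| ≤ |t - s| := Set.abs_sub_left_of_mem_uIcc hτ
      -- `M` may only be negative when both powers vanish
      have hM0 : 0 ≤ M ∨ |τ - s| ^ n = 0 ∧ |t - s| ^ n = 0 := by
        by_cases h0 : |t - s| ^ n = 0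
        · right
          refine ⟨le_antisymm ?_ (by positivity), h0⟩
          rw [← h0]; gcongr
        · left
          have hpos : 0 < |t - s| ^ n := lt_of_le_of_ne (by positivity) (Ne.symm h0)
          have := (norm_nonneg _).trans (hstep t Set.right_mem_uIcc)
          exact nonneg_of_mul_nonneg_left this hpos
      refine (hstep τ hτ).trans ?_
      rcases hM0 with hM0 | ⟨h1, h2⟩
      · gcongr
      · rw [h1, h2]
    have := (convex_uIcc s t).norm_image_sub_le_of_norm_hasDerivWithin_le hderiv hbound
      Set.left_mem_uIcc Set.right_mem_uIcc
    simp only [sub_self, lieTaylor_zero_right, sub_zero] at this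
    calc _ ≤ _ := this
      _ = _ := by rw [Real.norm_eq_abs, pow_succ]; ring

end LieSeries

/-! ### Local flows -/

section Flow

variable {F : Type*} [NormedAddCommGroup F] [NormedSpace ℝ F]
  {G : Type*} [NormedAddCommGroup G] [NormedSpace ℝ G]

/-- `ϕ (x, t)` is a flow of the vector field `X` for `x` near `x₀` and `t` near `0`. -/
structure IsLocalFlow (X : F → F) (x₀ : F) (ϕ : F × ℝ → F) : Prop where
  tendsto : Tendsto ϕ (𝓝 (x₀, 0)) (𝓝 x₀)
  initial : ∀ᶠ x in 𝓝 x₀, ϕ (x, 0) = x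
  hasDerivAt : ∀ᶠ p in 𝓝 (x₀, (0 : ℝ)), HasDerivAt (fun t => ϕ (p.1, t)) (X (ϕ p)) p.2

lemma exists_isLocalFlow [CompleteSpace F] {X : F → F} {x₀ : F} (hX : ContDiffAt ℝ ∞ X x₀) :
    ∃ ϕ, IsLocalFlow X x₀ ϕ := by
  have h1 : ContDiffAt ℝ 1 X x₀ := hX.of_le (by exact_mod_cast le_top)
  obtain ⟨ε, hε, a, r, _, _, hr, hpl⟩ := IsPicardLindelof.of_contDiffAt_one h1
  obtain ⟨ϕ, h2, h3⟩ := (hpl 0).exists_forall_mem_closedBall_eq_hasDerivWithinAt_continuousOn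
  simp only [zero_sub, zero_add] at h2 h3
  have hball : Metric.closedBall x₀ (r : ℝ) ∈ 𝓝 x₀ := Metric.closedBall_mem_nhds _ hr
  have hI : Set.Icc (-ε) ε ∈ 𝓝 (0 : ℝ) := Icc_mem_nhds (by linarith) hε
  refine ⟨ϕ, ?_, ?_, ?_⟩
  · have := (h3 (x₀, 0) ⟨mem_of_mem_nhds hball, mem_of_mem_nhds hI⟩).continuousAt
      (prod_mem_nhds hball hI)
    have h4 : ϕ (x₀, 0) = x₀ := (h2 x₀ (mem_of_mem_nhds hball)).1
    simpa [ContinuousAt, h4] using this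
  · filter_upwards [hball] with x hx using (h2 x hx).1
  · filter_upwards [prod_mem_nhds hball (Ioo_mem_nhds (neg_lt_zero.2 hε) hε)] with p hp
    exact ((h2 p.1 hp.1).2 p.2 (Set.Ioo_subset_Icc_self hp.2)).hasDerivAt
      (Icc_mem_nhds hp.2.1 hp.2.2)

lemma tendsto_fst_const_mul {F : Type*} [TopologicalSpace F] (x₀ : F) (α : ℝ) :
    Tendsto (fun p : F × ℝ => (p.1, α * p.2)) (𝓝 (x₀, 0)) (𝓝 (x₀, 0)) := by
  have : Continuous fun p : F × ℝ => (p.1, α * p.2) := by fun_prop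
  simpa using this.tendsto (x₀, (0 : ℝ))

lemma tendsto_prodMk_neg {F : Type*} [TopologicalSpace F] {x₀ : F} {Γ : F × ℝ → F}
    (hΓ : Tendsto Γ (𝓝 (x₀, 0)) (𝓝 x₀)) :
    Tendsto (fun p : F × ℝ => (Γ p, -p.2)) (𝓝 (x₀, 0)) (𝓝 (x₀, 0)) := by
  refine hΓ.prodMk_nhds ?_
  have : Continuous fun p : F × ℝ => -p.2 := by fun_prop
  simpa using this.tendsto (x₀, (0 : ℝ))

/-- A property that holds near `(x₀, 0)` holds at all times between `α h` and `β h`. -/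
lemma eventually_forall_uIcc {F : Type*} [TopologicalSpace F] {x₀ : F} {P : F × ℝ → Prop}
    (hP : ∀ᶠ p in 𝓝 (x₀, (0 : ℝ)), P p) (α β : ℝ) :
    ∀ᶠ p in 𝓝 (x₀, (0 : ℝ)), ∀ τ ∈ Set.uIcc (α * p.2) (β * p.2), P (p.1, τ) := by
  rw [nhds_prod_eq, eventually_prod_iff] at hP
  obtain ⟨pa, ha, pb, hb, h⟩ := hP
  obtain ⟨ε, hε, hball⟩ := Metric.eventually_nhds_iff.1 hb
  have h1 := (tendsto_fst_const_mul x₀ α).snd_nhds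
  have h2 := (tendsto_fst_const_mul x₀ β).snd_nhds
  filter_upwards [(tendsto_fst_const_mul x₀ α).fst_nhds.eventually ha,
    h1.eventually (Metric.ball_mem_nhds 0 hε), h2.eventually (Metric.ball_mem_nhds 0 hε)]
    with p hp1 hp2 hp3 τ hτ
  refine h hp1 (hball ?_)
  have : Set.uIcc (α * p.2) (β * p.2) ⊆ Metric.ball (0 : ℝ) ε :=
    (convex_ball (0 : ℝ) ε).ordConnected.uIcc_subset hp2 hp3
  exact this hτ

lemma IsLocalFlow.tendsto_const_mul {X : F → F} {x₀ : F} {ϕ : F × ℝ → F}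
    (hϕ : IsLocalFlow X x₀ ϕ) (α : ℝ) :
    Tendsto (fun p : F × ℝ => ϕ (p.1, α * p.2)) (𝓝 (x₀, 0)) (𝓝 x₀) :=
  hϕ.tendsto.comp (tendsto_fst_const_mul x₀ α)

/-- Taylor's theorem along a local flow, expanded at time `β h` and evaluated at time `α h`. -/
lemma IsLocalFlow.taylor {X : F → F} {x₀ : F} {ϕ : F × ℝ → F}
    (hϕ : IsLocalFlow X x₀ ϕ) (hX : ContDiffAt ℝ ∞ X x₀) {φ : F → G} (hφ : ContDiffAt ℝ ∞ φ x₀)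
    (n : ℕ) (α β : ℝ) :
    (fun p : F × ℝ => φ (ϕ (p.1, α * p.2)) -
      lieTaylor X φ n ((α - β) * p.2) (ϕ (p.1, β * p.2))) =O[𝓝 (x₀, 0)] fun p => p.2 ^ n := by
  obtain ⟨B, hB, M, hM⟩ := exists_taylor_along_curve hX n hφ
  refine IsBigO.of_bound (M * |α - β| ^ n) ?_
  filter_upwards [eventually_forall_uIcc ((hϕ.tendsto.eventually hB).and hϕ.hasDerivAt) β α]
    with p hp
  have := hM (fun t => ϕ (p.1, t)) (β * p.2) (α * p.2) hp
  rw [← sub_mul] at this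
  simpa [abs_mul, mul_pow, mul_assoc] using this

/-- Taylor's theorem along a local flow, expanded at time `0`. -/
lemma IsLocalFlow.taylor_zero {X : F → F} {x₀ : F} {ϕ : F × ℝ → F}
    (hϕ : IsLocalFlow X x₀ ϕ) (hX : ContDiffAt ℝ ∞ X x₀) {φ : F → G} (hφ : ContDiffAt ℝ ∞ φ x₀)
    (n : ℕ) (α : ℝ) :
    (fun p : F × ℝ => φ (ϕ (p.1, α * p.2)) - lieTaylor X φ n (α * p.2) p.1)
      =O[𝓝 (x₀, 0)] fun p => p.2 ^ n := by
  refine (hϕ.taylor hX hφ n α 0).congr' ?_ EventuallyEq.rfl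
  filter_upwards [(continuous_fst.tendsto (x₀, (0 : ℝ))).eventually hϕ.initial] with p hp
  simp [hp]

end Flow

/-! ### Smooth functions vanishing to a given order in the step size -/

section Germs

variable {F : Type*} [NormedAddCommGroup F] [NormedSpace ℝ F]
  {G : Type*} [NormedAddCommGroup G] [NormedSpace ℝ G]

lemma isBigO_comp_sub_comp {A B P : Type*} [NormedAddCommGroup A] [NormedSpace ℝ A]
    [NormedAddCommGroup B] [NormedSpace ℝ B] {f : A → B} {y₀ : A} (hf : ContDiffAt ℝ ∞ f y₀)
    {l : Filter P} {a b : P → A} (ha : Tendsto a l (𝓝 y₀)) (hb : Tendsto b l (𝓝 y₀)) :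
    (fun p => f (a p) - f (b p)) =O[l] fun p => a p - b p :=
  ((hf.hasStrictFDerivAt (by simp)).isBigO_sub).comp_tendsto (ha.prodMk_nhds hb)

lemma isBigO_sub_apply_zero {x₀ : F} {f : F × ℝ → G} (hf : ContDiffAt ℝ ∞ f (x₀, 0)) :
    (fun p => f p - f (p.1, 0)) =O[𝓝 (x₀, 0)] fun p => p.2 := by
  have h1 : Tendsto (fun p : F × ℝ => (p.1, (0 : ℝ))) (𝓝 (x₀, 0)) (𝓝 (x₀, 0)) := by
    have : Continuous fun p : F × ℝ => (p.1, (0 : ℝ)) := by fun_prop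
    exact this.tendsto (x₀, (0 : ℝ))
  refine (isBigO_comp_sub_comp hf tendsto_id h1).trans
    (IsBigO.of_bound 1 (Eventually.of_forall fun p => ?_))
  simp [Prod.norm_def]

lemma isBigO_pow_of_le {F : Type*} [TopologicalSpace F] {x₀ : F} {m n : ℕ} (h : m ≤ n) :
    (fun p : F × ℝ => p.2 ^ n) =O[𝓝 (x₀, 0)] fun p => p.2 ^ m := by
  refine IsBigO.of_bound 1 ?_
  have h1 : ∀ᶠ p : F × ℝ in 𝓝 (x₀, 0), p.2 ∈ Metric.ball (0 : ℝ) 1 :=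
    (continuous_snd.tendsto (x₀, (0 : ℝ))).eventually (Metric.ball_mem_nhds 0 one_pos)
  filter_upwards [h1] with p hp
  rw [mem_ball_zero_iff] at hp
  simpa using pow_le_pow_of_le_one (norm_nonneg p.2) hp.le h

/-- A smooth function that is `O(h^n)` for `h ≠ 0` is `O(h^n)`, by continuity at `h = 0`. -/
lemma isBigO_of_isBigO_ne_zero {x₀ : F} {f : F × ℝ → G} (hf : ContDiffAt ℝ ∞ f (x₀, 0)) {n : ℕ}
    (h : f =O[𝓝 (x₀, 0) ⊓ 𝓟 {p | p.2 ≠ 0}] fun p => p.2 ^ n) :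
    f =O[𝓝 (x₀, 0)] fun p => p.2 ^ n := by
  obtain ⟨C, hC⟩ := h.bound
  refine IsBigO.of_bound C ?_
  rw [eventually_inf_principal] at hC
  filter_upwards [hC.eventually_nhds, eventually_differentiableAt hf] with p hp hfp
  by_cases hp0 : p.2 = 0
  · have hcurve : Tendsto (fun t : ℝ => (p.1, t)) (𝓝[≠] 0) (𝓝 p) := by
      have : Continuous fun t : ℝ => (p.1, t) := by fun_prop
      have h1 := this.tendsto 0
      rw [show (p.1, (0 : ℝ)) = p from Prod.ext rfl hp0.symm] at h1
      exact h1.mono_left nhdsWithin_le_nhds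
    have h1 := (hfp.continuousAt.norm.tendsto.comp hcurve)
    have h2 : Tendsto (fun t : ℝ => C * ‖t ^ n‖) (𝓝[≠] 0) (𝓝 (C * ‖p.2 ^ n‖)) := by
      have : Continuous fun t : ℝ => C * ‖t ^ n‖ := by fun_prop
      rw [hp0]
      exact (this.tendsto 0).mono_left nhdsWithin_le_nhds
    refine le_of_tendsto_of_tendsto h1 h2 ?_
    filter_upwards [hcurve.eventually hp, self_mem_nhdsWithin] with t ht ht0
    exact ht ht0
  · exact hp.self_of_nhds hp0

lemma isBigO_of_smul_isBigO {x₀ : F} {f : F × ℝ → G} (hf : ContDiffAt ℝ ∞ f (x₀, 0)) {n : ℕ}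
    (h : (fun p => p.2 • f p) =O[𝓝 (x₀, 0)] fun p => p.2 ^ (n + 1)) :
    f =O[𝓝 (x₀, 0)] fun p => p.2 ^ n := by
  refine isBigO_of_isBigO_ne_zero hf ?_
  obtain ⟨C, hC⟩ := h.bound
  refine IsBigO.of_bound C ?_
  rw [eventually_inf_principal]
  filter_upwards [hC] with p hp hp0
  rw [norm_smul, pow_succ', norm_mul, mul_left_comm] at hp
  exact le_of_mul_le_mul_left hp (norm_pos_iff.2 hp0)

/-- A polynomial of degree less than `n` in `h` that is `O(h^n)` vanishes. -/
lemma coeff_eq_zero_of_isBigO (n : ℕ) : ∀ a : ℕ → G,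
    (fun h : ℝ => ∑ k ∈ Finset.range n, h ^ k • a k) =O[𝓝[≠] 0] (fun h => h ^ n) →
    ∀ k < n, a k = 0 := by
  induction n with
  | zero => intro a _ k hk; omega
  | succ n ih =>
    intro a h
    have h0 : a 0 = 0 := by
      have h1 : Tendsto (fun h : ℝ => ∑ k ∈ Finset.range (n + 1), h ^ k • a k) (𝓝[≠] 0)
          (𝓝 (a 0)) := by
        have : Continuous fun h : ℝ => ∑ k ∈ Finset.range (n + 1), h ^ k • a k := by fun_prop
        have h2 := this.tendsto 0
        simp only [Finset.sum_range_succ', pow_zero, one_smul] at h2 ⊢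
        simpa using h2.mono_left nhdsWithin_le_nhds
      have h2 : Tendsto (fun h : ℝ => h ^ (n + 1)) (𝓝[≠] 0) (𝓝 0) := by
        have : Continuous fun h : ℝ => h ^ (n + 1) := by fun_prop
        simpa using (this.tendsto 0).mono_left nhdsWithin_le_nhds
      exact tendsto_nhds_unique h1 (h.trans_tendsto h2)
    have h1 := ih (fun k => a (k + 1)) ?_
    · intro k hk
      cases k with
      | zero => exact h0
      | succ k => exact h1 k (by omega)
    obtain ⟨C, hC⟩ := h.bound
    refine IsBigO.of_bound C ?_
    filter_upwards [hC, self_mem_nhdsWithin] with t ht ht0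
    have : ∑ k ∈ Finset.range (n + 1), t ^ k • a k
        = t • ∑ k ∈ Finset.range n, t ^ k • a (k + 1) := by
      rw [Finset.sum_range_succ', Finset.smul_sum, h0]
      simp [pow_succ', smul_smul]
    rw [this, norm_smul, pow_succ', norm_mul, mul_left_comm] at ht
    exact le_of_mul_le_mul_left ht (norm_pos_iff.2 ht0)

/-- The derivative of `f (x, h)` with respect to the step size `h`. -/
def derivH (f : F × ℝ → G) (p : F × ℝ) : G := fderiv ℝ f p (0, 1)

/-- The derivative of `f (x, h)` with respect to the initial value `x`. -/
def derivX (f : F × ℝ → G) (p : F × ℝ) : F →L[ℝ] G :=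
  (fderiv ℝ f p).comp (ContinuousLinearMap.inl ℝ F ℝ)

lemma contDiffAt_derivH {x₀ : F} {f : F × ℝ → G} (hf : ContDiffAt ℝ ∞ f (x₀, 0)) :
    ContDiffAt ℝ ∞ (derivH f) (x₀, 0) :=
  (hf.fderiv_right (m := ∞) (by simp)).clm_apply contDiffAt_const

lemma contDiffAt_derivX {x₀ : F} {f : F × ℝ → G} (hf : ContDiffAt ℝ ∞ f (x₀, 0)) :
    ContDiffAt ℝ ∞ (derivX f) (x₀, 0) :=
  (hf.fderiv_right (m := ∞) (by simp)).clm_comp contDiffAt_const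

lemma hasDerivAt_derivH {f : F × ℝ → G} {p : F × ℝ} (hf : DifferentiableAt ℝ f p) :
    HasDerivAt (fun t => f (p.1, t)) (derivH f p) p.2 :=
  HasFDerivAt.comp_hasDerivAt (f := fun t => (p.1, t)) (l := f) (l' := fderiv ℝ f p) p.2
    hf.hasFDerivAt ((hasDerivAt_const _ _).prodMk (hasDerivAt_id _))

lemma derivX_eq {f : F × ℝ → G} {p : F × ℝ} (hf : DifferentiableAt ℝ f p) :
    derivX f p = fderiv ℝ (fun x => f (x, p.2)) p.1 := by
  have h1 : HasFDerivAt (fun x : F => (x, p.2)) (ContinuousLinearMap.inl ℝ F ℝ) p.1 :=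
    hasFDerivAt_prodMk_left p.1 p.2
  exact (HasFDerivAt.comp (g := f) (f := fun x : F => (x, p.2)) p.1
    (by exact hf.hasFDerivAt) h1).fderiv.symm

lemma lieIter_const_eq_derivH (f : F × ℝ → G) (k : ℕ) :
    lieIter (fun _ => ((0 : F), (1 : ℝ))) f (k + 1) =
      lieIter (fun _ => ((0 : F), (1 : ℝ))) (derivH f) k :=
  lieIter_succ' _ f k

/-- Taylor's theorem in the step size, at `h = 0`. -/
lemma isBigO_sub_lieTaylor_const {x₀ : F} {f : F × ℝ → G} (hf : ContDiffAt ℝ ∞ f (x₀, 0)) (n : ℕ) :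
    (fun p : F × ℝ => f p - lieTaylor (fun _ => ((0 : F), (1 : ℝ))) f n p.2 (p.1, 0))
      =O[𝓝 (x₀, 0)] fun p => p.2 ^ n := by
  obtain ⟨B, hB, M, hM⟩ := exists_taylor_along_curve (X := fun _ => ((0 : F), (1 : ℝ)))
    contDiffAt_const n hf
  refine IsBigO.of_bound M ?_
  filter_upwards [eventually_forall_uIcc hB 0 1] with p hp
  have := hM (fun t => (p.1, t)) 0 p.2 fun τ hτ => ⟨hp τ (by simpa using hτ),
    (hasDerivAt_const τ p.1).prodMk (hasDerivAt_id τ)⟩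
  simpa using this

/-- If a smooth function is `O(h^n)` then its derivatives in `h` of order less than `n` vanish
at `h = 0`. -/
lemma eventually_lieIter_const_eq_zero {x₀ : F} {f : F × ℝ → G} (hf : ContDiffAt ℝ ∞ f (x₀, 0))
    {n : ℕ} (h : f =O[𝓝 (x₀, 0)] fun p => p.2 ^ n) :
    ∀ᶠ x in 𝓝 x₀, ∀ k < n, lieIter (fun _ => ((0 : F), (1 : ℝ))) f k (x, 0) = 0 := by
  have h1 := (isBigO_sub_lieTaylor_const hf n).symm.add h
  simp only [sub_add_cancel] at h1
  obtain ⟨C, hC⟩ := h1.bound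
  rw [nhds_prod_eq] at hC
  filter_upwards [hC.curry] with x hx k hk
  have h2 := coeff_eq_zero_of_isBigO n
    (fun k => (1 / (k.factorial : ℝ)) • lieIter (fun _ => ((0 : F), (1 : ℝ))) f k (x, 0))
    (IsBigO.of_bound C ?_) k hk
  · exact (smul_eq_zero.1 h2).resolve_left (by positivity)
  · filter_upwards [nhdsWithin_le_nhds hx] with t ht
    simpa [lieTaylor, smul_smul, div_eq_mul_inv] using ht

lemma isBigO_derivH {x₀ : F} {f : F × ℝ → G} (hf : ContDiffAt ℝ ∞ f (x₀, 0))
    {n : ℕ} (h : f =O[𝓝 (x₀, 0)] fun p => p.2 ^ (n + 1)) :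
    derivH f =O[𝓝 (x₀, 0)] fun p => p.2 ^ n := by
  refine (isBigO_sub_lieTaylor_const (contDiffAt_derivH hf) n).congr' ?_ EventuallyEq.rfl
  filter_upwards [(continuous_fst.tendsto (x₀, (0 : ℝ))).eventually
    (eventually_lieIter_const_eq_zero hf h)] with p hp
  rw [lieTaylor, Finset.sum_eq_zero, sub_zero]
  intro k hk
  rw [← lieIter_const_eq_derivH, hp _ (by simpa using hk), smul_zero]

/-- Integration in the step size gains one order. -/
lemma isBigO_of_isBigO_derivH {x₀ : F} {f : F × ℝ → G} (hf : ContDiffAt ℝ ∞ f (x₀, 0))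
    {n : ℕ} (h0 : ∀ᶠ x in 𝓝 x₀, f (x, 0) = 0)
    (h : derivH f =O[𝓝 (x₀, 0)] fun p => p.2 ^ n) :
    f =O[𝓝 (x₀, 0)] fun p => p.2 ^ (n + 1) := by
  obtain ⟨C, hC0, hC⟩ := h.exists_nonneg
  refine IsBigO.of_bound C ?_
  filter_upwards [eventually_forall_uIcc ((eventually_differentiableAt hf).and hC.bound) 0 1,
    (continuous_fst.tendsto (x₀, (0 : ℝ))).eventually h0] with p hp hp0
  simp only [zero_mul, one_mul] at hp
  have h1 : ∀ τ ∈ Set.uIcc 0 p.2, HasDerivWithinAt (fun t => f (p.1, t)) (derivH f (p.1, τ))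
      (Set.uIcc 0 p.2) τ := fun τ hτ => (hasDerivAt_derivH (hp τ hτ).1).hasDerivWithinAt
  have h2 : ∀ τ ∈ Set.uIcc 0 p.2, ‖derivH f (p.1, τ)‖ ≤ C * |p.2| ^ n := by
    intro τ hτ
    have h3 : |τ| ≤ |p.2| := by simpa using Set.abs_sub_left_of_mem_uIcc hτ
    refine (hp τ hτ).2.trans ?_
    rw [norm_pow, Real.norm_eq_abs]
    gcongr
  have := (convex_uIcc 0 p.2).norm_image_sub_le_of_norm_hasDerivWithin_le h1 h2
    Set.left_mem_uIcc Set.right_mem_uIcc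
  rw [hp0, sub_zero, sub_zero] at this
  simpa [pow_succ, mul_assoc] using this

lemma eventually_derivH_derivX {x₀ : F} {f : F × ℝ → G} (hf : ContDiffAt ℝ ∞ f (x₀, 0)) :
    ∀ᶠ p in 𝓝 (x₀, (0 : ℝ)), derivH (derivX f) p = derivX (derivH f) p := by
  have h2 : ContDiffAt ℝ 2 f (x₀, 0) := contDiffAt_infty.1 hf 2
  filter_upwards [h2.eventually (by simp),
    eventually_differentiableAt (hf.fderiv_right (m := ∞) (by simp))] with p hp hdp
  have hs := hp.isSymmSndFDerivAt (by simp)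
  ext ξ
  have h3 : derivH (derivX f) p ξ = fderiv ℝ (fderiv ℝ f) p (0, 1) (ξ, 0) := by
    have := (hdp.hasFDerivAt.clm_comp (hasFDerivAt_const (ContinuousLinearMap.inl ℝ F ℝ) p)).fderiv
    unfold derivH derivX
    rw [this]
    simp
  have h4 : derivX (derivH f) p ξ = fderiv ℝ (fderiv ℝ f) p (ξ, 0) (0, 1) := by
    have := (hdp.hasFDerivAt.clm_apply (hasFDerivAt_const ((0 : F), (1 : ℝ)) p)).fderiv
    unfold derivX derivH
    rw [this]
    simp
  rw [h3, h4, hs]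

/-- Differentiation in the initial value preserves the order in the step size: this passes to the
`h`-derivative, which commutes with `derivX`, and integrates back. -/
lemma isBigO_derivX (n : ℕ) : ∀ {x₀ : F} {f : F × ℝ → G}, ContDiffAt ℝ ∞ f (x₀, 0) →
    f =O[𝓝 (x₀, 0)] (fun p => p.2 ^ n) → derivX f =O[𝓝 (x₀, 0)] fun p => p.2 ^ n := by
  induction n with
  | zero =>
    intro x₀ f hf _
    simpa using (contDiffAt_derivX hf).continuousAt.norm.isBoundedUnder_le.isBigO_one ℝ
  | succ n ih =>
    intro x₀ f hf h
    refine isBigO_of_isBigO_derivH (contDiffAt_derivX hf) ?_ ?_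
    · have h0 := (eventually_lieIter_const_eq_zero hf h).eventually_nhds
      have hd : ∀ᶠ x in 𝓝 x₀, DifferentiableAt ℝ f (x, 0) :=
        (Continuous.prodMk_left (0 : ℝ)).tendsto x₀ |>.eventually (eventually_differentiableAt hf)
      filter_upwards [h0, hd] with x hx hdx
      rw [derivX_eq hdx]
      have : (fun y => f (y, 0)) =ᶠ[𝓝 x] fun _ => 0 := by
        filter_upwards [hx] with y hy using hy 0 (by omega)
      rw [this.fderiv_eq]; simp
    · refine (ih (contDiffAt_derivH hf) (isBigO_derivH hf h)).congr' ?_ EventuallyEq.rfl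
      filter_upwards [eventually_derivH_derivX hf] with p hp using hp.symm

end Germs

/-! ### The Euler--Lagrange vector field -/

section EulerLagrange

variable {E : Type*} [NormedAddCommGroup E] [NormedSpace ℝ E]

/-- The implicit function theorem for an equation `Z (q, v, h) = w` in the unknown `v`, with
`∂Z/∂v` invertible: `V` is a smooth local inverse of `Z` in the velocity variable. -/
lemma exists_velocity_inverse [CompleteSpace E] {E' : Type*} [NormedAddCommGroup E']
    [NormedSpace ℝ E'] {Z : (E × E) × ℝ → E'} {q₀ v₀ : E} {w₀ : E'}
    (hZ : ContDiffAt ℝ ∞ Z ((q₀, v₀), 0)) (hw : Z ((q₀, v₀), 0) = w₀) {A : E ≃L[ℝ] E'}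
    (hA : HasFDerivAt (fun v => Z ((q₀, v), 0)) (A : E →L[ℝ] E') v₀) :
    ∃ V : (E × E') × ℝ → E, ContDiffAt ℝ ∞ V ((q₀, w₀), 0) ∧ V ((q₀, w₀), 0) = v₀ ∧
      (∀ᶠ p in 𝓝 ((q₀, w₀), (0 : ℝ)), Z ((p.1.1, V p), p.2) = p.1.2) ∧
      ∀ᶠ p in 𝓝 ((q₀, v₀), (0 : ℝ)), V ((p.1.1, Z p), p.2) = p.1.2 := by
  subst hw
  set p₀ : (E × E) × ℝ := ((q₀, v₀), 0)
  set D := fderiv ℝ Z p₀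
  have hD : HasFDerivAt Z D p₀ := (hZ.differentiableAt (by simp)).hasFDerivAt
  have hDA : ∀ b : E, D ((0, b), 0) = A b := by
    have h1 : HasFDerivAt (fun v : E => ((q₀, v), (0 : ℝ)))
        ((ContinuousLinearMap.inl ℝ (E × E) ℝ).comp (ContinuousLinearMap.inr ℝ E E)) v₀ :=
      (hasFDerivAt_prodMk_left (𝕜 := ℝ) (q₀, v₀) (0 : ℝ)).comp v₀ (hasFDerivAt_prodMk_right q₀ v₀)
    have h2 := (HasFDerivAt.comp (g := Z) v₀ hD h1).unique hA
    intro b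
    simpa using congrArg (fun T => T b) h2
  have hsplit : ∀ (a b : E) (t : ℝ), D ((a, b), t) = D ((a, 0), t) + A b := by
    intro a b t
    rw [← hDA, ← map_add]; simp
  set Θ : (E × E) × ℝ → (E × E') × ℝ := fun p => ((p.1.1, Z p), p.2)
  set Θ' : (E × E) × ℝ →L[ℝ] (E × E') × ℝ :=
    ((((ContinuousLinearMap.fst ℝ E E).comp (ContinuousLinearMap.fst ℝ (E × E) ℝ)).prod D).prod
      (ContinuousLinearMap.snd ℝ (E × E) ℝ)) with hΘ'
  set pr : (E × E') × ℝ →L[ℝ] E :=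
    (ContinuousLinearMap.fst ℝ E E').comp (ContinuousLinearMap.fst ℝ (E × E') ℝ)
  set emb : (E × E') × ℝ →L[ℝ] (E × E) × ℝ :=
    (pr.prod 0).prod (ContinuousLinearMap.snd ℝ (E × E') ℝ)
  set inv : (E × E') × ℝ →L[ℝ] (E × E) × ℝ :=
    (pr.prod ((A.symm : E' →L[ℝ] E).comp
      ((ContinuousLinearMap.snd ℝ E E').comp (ContinuousLinearMap.fst ℝ (E × E') ℝ)
        - D.comp emb))).prod (ContinuousLinearMap.snd ℝ (E × E') ℝ)
  have hl : Function.LeftInverse inv Θ' := by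
    rintro ⟨⟨a, b⟩, t⟩
    simp [inv, Θ', pr, emb, hsplit a b t]
  have hr : Function.RightInverse inv Θ' := by
    rintro ⟨⟨a, c⟩, t⟩
    simp [inv, Θ', pr, emb]
    rw [hsplit]
    simp
  set e : ((E × E) × ℝ) ≃L[ℝ] (E × E') × ℝ := ContinuousLinearEquiv.equivOfInverse Θ' inv hl hr
  have hΘs : ContDiffAt ℝ ∞ Θ p₀ :=
    ((contDiffAt_fst.comp p₀ contDiffAt_fst).prodMk hZ).prodMk contDiffAt_snd
  have hΘd : HasFDerivAt Θ (e : (E × E) × ℝ →L[ℝ] (E × E') × ℝ) p₀ :=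
    (((hasFDerivAt_fst.comp p₀ hasFDerivAt_fst).prodMk hD).prodMk hasFDerivAt_snd)
  have hstrict := hΘs.hasStrictFDerivAt' hΘd (by simp)
  have hE' : CompleteSpace E' := (completeSpace_congr (e := A.toEquiv)
    A.isUniformEmbedding).1 inferInstance
  refine ⟨fun y => (hΘs.localInverse hΘd (by simp) y).1.2, ?_, ?_, ?_, ?_⟩
  · exact contDiffAt_snd.comp _ (contDiffAt_fst.comp _ (hΘs.to_localInverse hΘd (by simp)))
  · have := hΘs.localInverse_apply_image hΘd (by simp)
    exact congrArg (fun p => p.1.2) this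
  · filter_upwards [hstrict.eventually_right_inverse] with y hy
    have h1 : (hΘs.localInverse hΘd (by simp) y).1.1 = y.1.1 := congrArg (fun p => p.1.1) hy
    have h2 : (hΘs.localInverse hΘd (by simp) y).2 = y.2 := congrArg (fun p => p.2) hy
    have h3 : Z (hΘs.localInverse hΘd (by simp) y) = y.1.2 := congrArg (fun p => p.1.2) hy
    rw [← h3, ← h1, ← h2]
  · filter_upwards [hstrict.eventually_left_inverse] with p hp
    exact congrArg (fun p => p.1.2) hp

lemma fderiv_partial_right {G : Type*} [NormedAddCommGroup G] [NormedSpace ℝ G] {φ : E × E → G}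
    {x : E × E} (hφ : DifferentiableAt ℝ φ x) :
    fderiv ℝ (fun v => φ (x.1, v)) x.2 = (fderiv ℝ φ x).comp (ContinuousLinearMap.inr ℝ E E) :=
  (HasFDerivAt.comp (g := φ) (f := fun v => (x.1, v)) x.2 (by exact hφ.hasFDerivAt)
    (hasFDerivAt_prodMk_right x.1 x.2)).fderiv

lemma fderiv_partial_left {G : Type*} [NormedAddCommGroup G] [NormedSpace ℝ G] {φ : E × E → G}
    {x : E × E} (hφ : DifferentiableAt ℝ φ x) :
    fderiv ℝ (fun q => φ (q, x.2)) x.1 = (fderiv ℝ φ x).comp (ContinuousLinearMap.inl ℝ E E) :=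
  (HasFDerivAt.comp (g := φ) (f := fun q => (q, x.2)) x.1 (by exact hφ.hasFDerivAt)
    (hasFDerivAt_prodMk_left x.1 x.2)).fderiv

lemma contDiffAt_partial_right {G : Type*} [NormedAddCommGroup G] [NormedSpace ℝ G]
    {φ : E × E → G} {x : E × E} (hφ : ContDiffAt ℝ ∞ φ x) :
    ContDiffAt ℝ ∞ (fun y : E × E => fderiv ℝ (fun v => φ (y.1, v)) y.2) x := by
  refine ((hφ.fderiv_right (m := ∞) (by simp)).clm_comp
    (contDiffAt_const (c := ContinuousLinearMap.inr ℝ E E))).congr_of_eventuallyEq ?_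
  filter_upwards [eventually_differentiableAt hφ] with y hy using fderiv_partial_right hy

lemma contDiffAt_partial_left {G : Type*} [NormedAddCommGroup G] [NormedSpace ℝ G]
    {φ : E × E → G} {x : E × E} (hφ : ContDiffAt ℝ ∞ φ x) :
    ContDiffAt ℝ ∞ (fun y : E × E => fderiv ℝ (fun q => φ (q, y.2)) y.1) x := by
  refine ((hφ.fderiv_right (m := ∞) (by simp)).clm_comp
    (contDiffAt_const (c := ContinuousLinearMap.inl ℝ E E))).congr_of_eventuallyEq ?_
  filter_upwards [eventually_differentiableAt hφ] with y hy using fderiv_partial_left hy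

/-- The Euler--Lagrange vector field `(q, v) ↦ (v, f (q, v))` on the tangent bundle. -/
def elField (L : E × E → ℝ) (x : E × E) : E × E := (x.2, accel L x)

lemma lieIter_fst_one (L : E × E → ℝ) :
    lieIter (elField L) (Prod.fst : E × E → E) 1 = Prod.snd := by
  funext x
  change fderiv ℝ Prod.fst x (x.2, accel L x) = x.2
  rw [fderiv_fst]; rfl

lemma prolong_eq_lieIter (L : E × E → ℝ) (k : ℕ) :
    prolong L k = lieIter (elField L) Prod.fst k := by
  induction k with
  | zero => rfl
  | succ k ih => funext x; rw [prolong, ih]; rfl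

lemma prolong_succ_eq_lieIter (L : E × E → ℝ) (k : ℕ) :
    prolong L (k + 1) = lieIter (elField L) Prod.snd k := by
  rw [prolong_eq_lieIter, lieIter_succ', lieIter_fst_one]

lemma taylorMap_eq (L : E × E → ℝ) (s : ℕ) (h : ℝ) (x : E × E) :
    taylorMap L s h x = (lieTaylor (elField L) Prod.fst (s + 1) h x,
      lieTaylor (elField L) Prod.snd (s + 1) h x) := by
  simp only [taylorMap, lieTaylor, prolong_succ_eq_lieIter]
  simp only [prolong_eq_lieIter]

lemma taylorMap_fst_eq (L : E × E → ℝ) (s : ℕ) (h : ℝ) (x : E × E) :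
    (taylorMap L s h x).1 = x.1 + h • lieMean (elField L) Prod.snd s h x := by
  rw [taylorMap_eq, lieTaylor_succ_eq, lieIter_fst_one]

lemma taylorMap_zero (L : E × E → ℝ) (s : ℕ) (x : E × E) : taylorMap L s 0 x = x := by
  rw [taylorMap_eq, lieTaylor_zero_right, lieTaylor_zero_right]

lemma fderiv_momentum_apply {L : E × E → ℝ} {x : E × E} (hd : DifferentiableAt ℝ (momentum L) x)
    (a b : E) : fderiv ℝ (momentum L) x (a, b) = mixedQV L x a + hessV L x b := by
  have h1 : mixedQV L x = _ := fderiv_partial_left hd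
  have h2 : hessV L x = _ := fderiv_partial_right hd
  rw [h1, h2]
  simp [← map_add]

/-- The Euler--Lagrange equation: the momentum changes at the rate `∂L/∂q` along the
Euler--Lagrange vector field. -/
lemma fderiv_momentum_elField {L : E × E → ℝ} {x : E × E} (hd : DifferentiableAt ℝ (momentum L) x)
    (hi : (hessV L x).IsInvertible) : fderiv ℝ (momentum L) x (elField L x) = partialQ L x := by
  obtain ⟨A, hA⟩ := hi
  rw [elField, fderiv_momentum_apply hd, accel, ← hA, ContinuousLinearMap.inverse_equiv]
  simp

/-- The Lagrangian is smooth near `x` and its fibre Hessian at `x` is invertible. -/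
structure RegularAt (L : E × E → ℝ) (x : E × E) : Prop where
  contDiffAt : ContDiffAt ℝ ∞ L x
  isInvertible : (hessV L x).IsInvertible

lemma IsRegularLagrangian.regularAt {Q : Set E} {L : E × E → ℝ} (hL : IsRegularLagrangian Q L)
    (hQ : IsOpen Q) {x : E × E} (hx : x.1 ∈ Q) : RegularAt L x :=
  ⟨hL.smooth.contDiffAt ((hQ.prod isOpen_univ).mem_nhds ⟨hx, trivial⟩),
    hL.nonsingular x ⟨hx, trivial⟩⟩

namespace RegularAt

variable {L : E × E → ℝ} {x : E × E}

lemma momentum (hx : RegularAt L x) : ContDiffAt ℝ ∞ (momentum L) x :=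
  contDiffAt_partial_right hx.contDiffAt

lemma partialQ (hx : RegularAt L x) : ContDiffAt ℝ ∞ (partialQ L) x :=
  contDiffAt_partial_left hx.contDiffAt

lemma hessV (hx : RegularAt L x) : ContDiffAt ℝ ∞ (hessV L) x :=
  contDiffAt_partial_right hx.momentum

lemma elField [CompleteSpace E] (hx : RegularAt L x) : ContDiffAt ℝ ∞ (elField L) x := by
  refine contDiffAt_snd.prodMk ?_
  have h2 : ContDiffAt ℝ ∞ (mixedQV L) x := contDiffAt_partial_left hx.momentum
  exact (hx.isInvertible.contDiffAt_map_inverse.comp x hx.hessV).clm_apply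
    (hx.partialQ.sub (h2.clm_apply contDiffAt_snd))

lemma hasFDerivAt_momentum (hx : RegularAt L x) :
    HasFDerivAt (fun v => TaylorVI.momentum L (x.1, v)) (TaylorVI.hessV L x) x.2 := by
  have hd : DifferentiableAt ℝ (TaylorVI.momentum L) x := hx.momentum.differentiableAt (by simp)
  have h1 := HasFDerivAt.comp (g := TaylorVI.momentum L) (f := fun v => (x.1, v)) x.2
    (by exact hd.hasFDerivAt) (hasFDerivAt_prodMk_right x.1 x.2)
  exact h1.differentiableAt.hasFDerivAt

lemma eventually_isInvertible [CompleteSpace E] (hx : RegularAt L x) :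
    ∀ᶠ y in 𝓝 x, (TaylorVI.hessV L y).IsInvertible := by
  obtain ⟨A, hA⟩ := hx.isInvertible
  exact hx.hessV.continuousAt.eventually (hA ▸ A.nhds)

end RegularAt

/-- An integral curve of the Euler--Lagrange vector field solves the Euler--Lagrange equation. -/
lemma isELSolution_of_hasDerivAt {Q : Set E} (hQ : IsOpen Q) {L : E × E → ℝ}
    (hL : IsRegularLagrangian Q L) {I : Set ℝ} {γ : ℝ → E × E} (hγ : ∀ t ∈ I, (γ t).1 ∈ Q)
    (hd : ∀ t ∈ I, HasDerivAt γ (elField L (γ t)) t) :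
    IsELSolution Q L I (fun t => (γ t).1) fun t => (γ t).2 where
  mem := hγ
  velocity t ht :=
    ((hasFDerivAt_fst (𝕜 := ℝ) (p := γ t)).comp_hasDerivAt t (hd t ht)).hasDerivWithinAt
  velocity_continuous t ht :=
    (continuousAt_snd.comp (hd t ht).continuousAt).continuousWithinAt
  eulerLagrange t ht := by
    have hr := hL.regularAt hQ (hγ t ht)
    have := (hr.momentum.differentiableAt (by simp)).hasFDerivAt.comp_hasDerivAt t (hd t ht)
    rw [fderiv_momentum_elField (hr.momentum.differentiableAt (by simp)) hr.isInvertible] at this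
    exact this.hasDerivWithinAt

/-- A solution of the Euler--Lagrange equation is an integral curve of the Euler--Lagrange vector
field. Its velocity is differentiable because the Legendre transformation is locally invertible. -/
lemma IsELSolution.hasDerivWithinAt [CompleteSpace E] {Q : Set E} (hQ : IsOpen Q) {L : E × E → ℝ}
    (hL : IsRegularLagrangian Q L) {I : Set ℝ} {q v : ℝ → E} (hs : IsELSolution Q L I q v)
    {t : ℝ} (ht : t ∈ I) (hI : UniqueDiffWithinAt ℝ I t) :
    HasDerivWithinAt (fun s => (q s, v s)) (elField L (q t, v t)) I t := by
  have hr : RegularAt L (q t, v t) := hL.regularAt hQ (hs.mem t ht)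
  obtain ⟨A, hA⟩ := hr.isInvertible
  have hZ : ContDiffAt ℝ ∞ (fun p : (E × E) × ℝ => momentum L p.1) ((q t, v t), 0) :=
    hr.momentum.comp ((q t, v t), (0 : ℝ)) contDiffAt_fst
  obtain ⟨V, hV, -, -, hinv⟩ := exists_velocity_inverse (A := A) hZ rfl
    (by rw [hA]; exact hr.hasFDerivAt_momentum)
  have hq := hs.velocity t ht
  have hcont : Tendsto (fun s => ((q s, v s), (0 : ℝ))) (𝓝[I] t) (𝓝 ((q t, v t), 0)) :=
    (hq.continuousWithinAt.prodMk (hs.velocity_continuous t ht)).prodMk continuousWithinAt_const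
  have hv : ∃ v', HasDerivWithinAt v v' I t := by
    have h1 : HasDerivWithinAt (fun s => ((q s, momentum L (q s, v s)), (0 : ℝ))) _ I t :=
      (hq.prodMk (hs.eulerLagrange t ht)).prodMk (hasDerivWithinAt_const t I 0)
    have h2 : HasFDerivAt V _ ((q t, momentum L (q t, v t)), (0 : ℝ)) :=
      (hV.differentiableAt (by simp)).hasFDerivAt
    have h3 := HasFDerivAt.comp_hasDerivWithinAt (l := V) t h2 h1
    have h4 := hcont.eventually hinv
    exact ⟨_, h3.congr_of_eventuallyEq (h4.mono fun s hs => hs.symm)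
      (h4.self_of_nhdsWithin ht).symm⟩
  obtain ⟨v', hv⟩ := hv
  have h1 := (hr.momentum.differentiableAt (by simp)).hasFDerivAt.comp_hasDerivWithinAt t
    (hq.prodMk hv)
  have h2 := hI.eq_deriv _ h1 (hs.eulerLagrange t ht)
  rw [fderiv_momentum_apply (hr.momentum.differentiableAt (by simp))] at h2
  have h3 : v' = accel L (q t, v t) := by
    rw [accel, ← h2, add_sub_cancel_left, ← hA, ContinuousLinearMap.inverse_equiv]; simp
  rw [elField, ← h3]
  exact hq.prodMk hv

/-- Two integral curves of `X` with the same initial value agree, on either side of time `0`. -/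
lemma eq_of_hasDerivWithinAt {F : Type*} [NormedAddCommGroup F] [NormedSpace ℝ F] {X : F → F}
    {h : ℝ} {γ₁ γ₂ : ℝ → F}
    (hX₁ : ∀ t ∈ Set.uIcc 0 h, ContDiffAt ℝ ∞ X (γ₁ t))
    (hX₂ : ∀ t ∈ Set.uIcc 0 h, ContDiffAt ℝ ∞ X (γ₂ t))
    (h₁ : ∀ t ∈ Set.uIcc 0 h, HasDerivWithinAt γ₁ (X (γ₁ t)) (Set.uIcc 0 h) t)
    (h₂ : ∀ t ∈ Set.uIcc 0 h, HasDerivWithinAt γ₂ (X (γ₂ t)) (Set.uIcc 0 h) t)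
    (h0 : γ₁ 0 = γ₂ 0) : γ₁ h = γ₂ h := by
  -- The rescaled curves `σ ↦ γ (σ h)` on `[0, 1]` treat both signs of `h` at once.
  set K := γ₁ '' Set.uIcc 0 h ∪ γ₂ '' Set.uIcc 0 h
  have hK : IsCompact K :=
    (isCompact_uIcc.image_of_continuousOn fun t ht => (h₁ t ht).continuousWithinAt).union
      (isCompact_uIcc.image_of_continuousOn fun t ht => (h₂ t ht).continuousWithinAt)
  have hlip : LocallyLipschitzOn K X := by
    have key : ∀ x, ContDiffAt ℝ ∞ X x → ∃ C, ∃ t ∈ 𝓝[K] x, LipschitzOnWith C X t := by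
      intro x hx
      obtain ⟨C, t, ht, hC⟩ := (contDiffAt_infty.1 hx 1).exists_lipschitzOnWith
      exact ⟨C, t, nhdsWithin_le_nhds ht, hC⟩
    rintro x (⟨t, ht, rfl⟩ | ⟨t, ht, rfl⟩)
    · exact key _ (hX₁ t ht)
    · exact key _ (hX₂ t ht)
  obtain ⟨C, hC⟩ := hlip.exists_lipschitzOnWith_of_compact hK
  have hmem : Set.MapsTo (fun σ : ℝ => σ * h) (Set.Icc 0 1) (Set.uIcc 0 h) := by
    intro σ hσ
    rcases le_total 0 h with hh | hh
    · rw [Set.uIcc_of_le hh]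
      exact ⟨mul_nonneg hσ.1 hh, mul_le_of_le_one_left hh hσ.2⟩
    · rw [Set.uIcc_of_ge hh]
      exact ⟨by nlinarith [hσ.1, hσ.2], mul_nonpos_of_nonneg_of_nonpos hσ.1 hh⟩
  have hres : ∀ γ : ℝ → F,
      (∀ t ∈ Set.uIcc 0 h, HasDerivWithinAt γ (X (γ t)) (Set.uIcc 0 h) t) →
      ∀ σ ∈ Set.Icc (0 : ℝ) 1, HasDerivWithinAt (fun σ => γ (σ * h)) (h • X (γ (σ * h)))
        (Set.Icc 0 1) σ := by
    intro γ hγ σ hσ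
    have hm : HasDerivWithinAt (fun σ : ℝ => σ * h) h (Set.Icc 0 1) σ := by
      simpa using ((hasDerivAt_id σ).mul_const h).hasDerivWithinAt
    exact (hγ _ (hmem hσ)).scomp σ hm hmem
  have hright : ∀ γ : ℝ → F,
      (∀ t ∈ Set.uIcc 0 h, HasDerivWithinAt γ (X (γ t)) (Set.uIcc 0 h) t) →
      ∀ σ ∈ Set.Ico (0 : ℝ) 1, HasDerivWithinAt (fun σ => γ (σ * h)) (h • X (γ (σ * h)))
        (Set.Ici σ) σ := fun γ hγ σ hσ =>
    (hres γ hγ σ ⟨hσ.1, hσ.2.le⟩).mono_of_mem_nhdsWithin (Icc_mem_nhdsGE_of_mem hσ)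
  have := ODE_solution_unique_of_mem_Icc_right (v := fun _ x => h • X x) (s := fun _ => K)
    (K := ‖h‖₊ * C) (a := 0) (b := 1) (f := fun σ => γ₁ (σ * h)) (g := fun σ => γ₂ (σ * h))
    (fun t _ => (lipschitzWith_smul h).comp_lipschitzOnWith hC)
    (fun σ hσ => (hres γ₁ h₁ σ hσ).continuousWithinAt) (hright γ₁ h₁)
    (fun σ hσ => Or.inl ⟨_, hmem ⟨hσ.1, hσ.2.le⟩, rfl⟩)
    (fun σ hσ => (hres γ₂ h₂ σ hσ).continuousWithinAt) (hright γ₂ h₂)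
    (fun σ hσ => Or.inr ⟨_, hmem ⟨hσ.1, hσ.2.le⟩, rfl⟩) (by simpa using h0)
    (Set.right_mem_Icc.2 zero_le_one)
  simpa using this

end EulerLagrange

/-! ### The inverse problem for the initial velocity -/

/-- A property that holds near every point `(x, 0)`, `x ∈ K`, with constants `ρ` and `C` depending
on the point, holds with uniform constants on a compact set `K` for all small step sizes. -/
lemma exists_uniform_of_compact {F : Type*} [TopologicalSpace F] {K : Set F} (hK : IsCompact K)
    {R : ℝ → ℝ → F × ℝ → Prop}
    (hR : ∀ {ρ ρ' C C' : ℝ} {p : F × ℝ}, ρ' ≤ ρ → C ≤ C' → R ρ C p → R ρ' C' p)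
    (hloc : ∀ x ∈ K, ∃ ρ > (0 : ℝ), ∃ C : ℝ, ∀ᶠ p in 𝓝 (x, (0 : ℝ)), p.2 ≠ 0 → R ρ C p) :
    ∃ ρ > (0 : ℝ), ∃ C > (0 : ℝ), ∃ h₀ > (0 : ℝ), ∀ x ∈ K, ∀ h : ℝ, 0 < |h| → |h| < h₀ →
      R ρ C (x, h) := by
  refine hK.induction_on (p := fun S => ∃ ρ > (0 : ℝ), ∃ C > (0 : ℝ), ∃ h₀ > (0 : ℝ), ∀ x ∈ S,
    ∀ h : ℝ, 0 < |h| → |h| < h₀ → R ρ C (x, h)) ?_ ?_ ?_ ?_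
  · exact ⟨1, one_pos, 1, one_pos, 1, one_pos, fun x hx => hx.elim⟩
  · rintro s t hst ⟨ρ, hρ, C, hC, h₀, hh₀, h⟩
    exact ⟨ρ, hρ, C, hC, h₀, hh₀, fun x hx => h x (hst hx)⟩
  · rintro s t ⟨ρ, hρ, C, hC, h₀, hh₀, h⟩ ⟨ρ', hρ', C', hC', h₀', hh₀', h'⟩
    refine ⟨min ρ ρ', lt_min hρ hρ', max C C', lt_max_of_lt_left hC, min h₀ h₀', lt_min hh₀ hh₀',
      ?_⟩
    rintro x (hx | hx) τ hτ hτ'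
    · exact hR (min_le_left _ _) (le_max_left _ _) (h x hx τ hτ (hτ'.trans_le (min_le_left _ _)))
    · exact hR (min_le_right _ _) (le_max_right _ _)
        (h' x hx τ hτ (hτ'.trans_le (min_le_right _ _)))
  · intro x hx
    obtain ⟨ρ, hρ, C, h⟩ := hloc x hx
    rw [nhds_prod_eq, eventually_prod_iff] at h
    obtain ⟨pa, ha, pb, hb, h⟩ := h
    obtain ⟨ε, hε, hball⟩ := Metric.eventually_nhds_iff.1 hb
    refine ⟨_, nhdsWithin_le_nhds ha, ρ, hρ, max C 1, lt_max_of_lt_right one_pos, ε, hε,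
      fun y hy τ hτ hτ' => ?_⟩
    exact hR le_rfl (le_max_left _ _) (h hy (hball (by simpa using hτ')) (abs_pos.1 hτ))

section InverseProblem

variable {E : Type*} [NormedAddCommGroup E] [NormedSpace ℝ E]

/-- `V ((q, w), h)` is a smooth local solution, near `(x₀, 0)`, of the inverse problem
`q + h w = π_Q Ψ^(r)_h (q, V)`, divided by `h`; it makes sense at `h = 0` too. -/
structure IsInverseVel (L : E × E → ℝ) (r : ℕ) (x₀ : E × E) (V : (E × E) × ℝ → E) : Prop where
  contDiffAt : ContDiffAt ℝ ∞ V (x₀, 0)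
  right_inv : ∀ᶠ p in 𝓝 (x₀, (0 : ℝ)), lieMean (elField L) Prod.snd r p.2 (p.1.1, V p) = p.1.2
  left_inv : ∀ᶠ p in 𝓝 (x₀, (0 : ℝ)),
    V ((p.1.1, lieMean (elField L) Prod.snd r p.2 p.1), p.2) = p.1.2

lemma exists_isInverseVel [CompleteSpace E] {L : E × E → ℝ} {x₀ : E × E} (hx : RegularAt L x₀)
    (r : ℕ) : ∃ V, IsInverseVel L (r + 1) x₀ V := by
  have hZ := contDiffAt_lieMean hx.elField (contDiffAt_snd (𝕜 := ℝ) (n := ∞)) (r + 1) 0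
  have h0 := lieMean_zero_right (elField L) (Prod.snd : E × E → E) r x₀
  have hA : HasFDerivAt (fun v => lieMean (elField L) (Prod.snd : E × E → E) (r + 1) 0 (x₀.1, v))
      ((ContinuousLinearEquiv.refl ℝ E : E ≃L[ℝ] E) : E →L[ℝ] E) x₀.2 := by
    simp only [lieMean_zero_right]
    exact hasFDerivAt_id x₀.2
  obtain ⟨V, h1, -, h3, h4⟩ := exists_velocity_inverse
    (Z := fun p => lieMean (elField L) (Prod.snd : E × E → E) (r + 1) p.2 p.1) hZ h0 hA
  exact ⟨V, h1, h3, h4⟩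

lemma solvesInverse_iff {L : E × E → ℝ} {r : ℕ} {h : ℝ} (hh : h ≠ 0) {q w v : E} :
    SolvesInverse L r h q (q + h • w) v ↔ lieMean (elField L) Prod.snd r h (q, v) = w := by
  rw [SolvesInverse, taylorMap_fst_eq, add_right_inj]
  exact ⟨fun h1 => smul_right_injective _ hh h1, fun h1 => by rw [h1]⟩

namespace IsInverseVel

variable {L : E × E → ℝ} {r : ℕ} {x₀ : E × E} {V : (E × E) × ℝ → E}

lemma eventually_zero (hV : IsInverseVel L (r + 1) x₀ V) : ∀ᶠ x in 𝓝 x₀, V (x, 0) = x.2 := by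
  filter_upwards [(Continuous.prodMk_left (0 : ℝ)).tendsto x₀ |>.eventually hV.left_inv] with x hx
  simpa [lieMean_zero_right] using hx

lemma tendsto (hV : IsInverseVel L (r + 1) x₀ V) : Tendsto V (𝓝 (x₀, 0)) (𝓝 x₀.2) := by
  have := hV.contDiffAt.continuousAt.tendsto
  rwa [hV.eventually_zero.self_of_nhds] at this

lemma sub_isBigO (hV : IsInverseVel L (r + 1) x₀ V) :
    (fun p => V p - p.1.2) =O[𝓝 (x₀, 0)] fun p => p.2 := by
  refine (isBigO_sub_apply_zero hV.contDiffAt).congr' ?_ EventuallyEq.rfl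
  filter_upwards [(continuous_fst.tendsto (x₀, (0 : ℝ))).eventually hV.eventually_zero] with p hp
  rw [hp]

/-- For small `h ≠ 0`, the value `V ((q, w), h)` is the only solution of the inverse problem in a
ball around `w` of fixed radius, hence the closest one to `w`. -/
lemma eventually_initVel_eq (hV : IsInverseVel L (r + 1) x₀ V) :
    ∃ ρ > (0 : ℝ), ∀ᶠ p in 𝓝 (x₀, (0 : ℝ)), p.2 ≠ 0 →
      initVel L (r + 1) p.2 p.1.1 (p.1.1 + p.2 • p.1.2) = V p ∧
      SolvesInverse L (r + 1) p.2 p.1.1 (p.1.1 + p.2 • p.1.2) (V p) ∧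
      ∀ v, ‖v - p.1.2‖ < ρ → SolvesInverse L (r + 1) p.2 p.1.1 (p.1.1 + p.2 • p.1.2) v →
        v = V p := by
  obtain ⟨ε, hε, hball⟩ := Metric.eventually_nhds_iff.1 hV.left_inv
  have hsmall : ∀ᶠ p : (E × E) × ℝ in 𝓝 (x₀, 0), ‖V p - p.1.2‖ < ε / 2 := by
    have h1 : Tendsto (fun p : (E × E) × ℝ => ‖V p - p.1.2‖) (𝓝 (x₀, 0)) (𝓝 ‖x₀.2 - x₀.2‖) :=
      (hV.tendsto.sub (by
        have : Continuous fun p : (E × E) × ℝ => p.1.2 := by fun_prop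
        exact this.tendsto (x₀, (0 : ℝ)))).norm
    refine h1.eventually_lt_const ?_
    simpa using hε
  refine ⟨ε / 2, half_pos hε, ?_⟩
  filter_upwards [hV.right_inv, hsmall, Metric.ball_mem_nhds (x₀, (0 : ℝ)) (half_pos hε)]
    with p hp hps hpb hp0
  have hsolve : SolvesInverse L (r + 1) p.2 p.1.1 (p.1.1 + p.2 • p.1.2) (V p) :=
    (solvesInverse_iff hp0).2 hp
  have huniq : ∀ v, ‖v - p.1.2‖ < ε / 2 →
      SolvesInverse L (r + 1) p.2 p.1.1 (p.1.1 + p.2 • p.1.2) v → v = V p := by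
    intro v hv hs
    rw [solvesInverse_iff hp0] at hs
    have hd : dist ((p.1.1, v), p.2) p < ε / 2 := by
      rw [dist_eq_norm]
      simpa [Prod.norm_def, hε] using hv
    have h1 := hball (y := ((p.1.1, v), p.2)) (by
      calc dist ((p.1.1, v), p.2) (x₀, 0) ≤ _ := dist_triangle _ p _
        _ < ε / 2 + ε / 2 := add_lt_add hd hpb
        _ = ε := by ring)
    simp only [hs] at h1
    exact h1.symm
  refine ⟨?_, hsolve, huniq⟩
  have hw : p.2⁻¹ • (p.1.1 + p.2 • p.1.2 - p.1.1) = p.1.2 := by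
    rw [add_sub_cancel_left, smul_smul, inv_mul_cancel₀ hp0, one_smul]
  have hclosest : ∀ v', SolvesInverse L (r + 1) p.2 p.1.1 (p.1.1 + p.2 • p.1.2) v' →
      ‖V p - p.1.2‖ ≤ ‖v' - p.1.2‖ := by
    intro v' hv'
    by_cases hc : ‖v' - p.1.2‖ < ε / 2
    · rw [huniq v' hc hv']
    · exact hps.le.trans (not_lt.1 hc)
  have hex : ∃ v, SolvesInverse L (r + 1) p.2 p.1.1 (p.1.1 + p.2 • p.1.2) v ∧
      ∀ v', SolvesInverse L (r + 1) p.2 p.1.1 (p.1.1 + p.2 • p.1.2) v' →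
        ‖v - p.2⁻¹ • (p.1.1 + p.2 • p.1.2 - p.1.1)‖
          ≤ ‖v' - p.2⁻¹ • (p.1.1 + p.2 • p.1.2 - p.1.1)‖ := by
    rw [hw]
    exact ⟨V p, hsolve, hclosest⟩
  have hspec := Classical.epsilon_spec hex
  rw [← initVel, hw] at hspec
  exact huniq _ ((hspec.2 _ hsolve).trans_lt hps) hspec.1

end IsInverseVel

theorem inverseWellPosed [CompleteSpace E] {Q : Set E} (hQ : IsOpen Q) {L : E × E → ℝ}
    (hL : IsRegularLagrangian Q L) (r : ℕ) : InverseWellPosed Q L (r + 1) := by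
  intro K hK hKQ
  obtain ⟨ρ, hρ, C, hC, h₀, hh₀, h⟩ := exists_uniform_of_compact hK
    (R := fun ρ C p =>
      ‖initVel L (r + 1) p.2 p.1.1 (p.1.1 + p.2 • p.1.2) - p.1.2‖ ≤ C * |p.2| ∧
      SolvesInverse L (r + 1) p.2 p.1.1 (p.1.1 + p.2 • p.1.2)
        (initVel L (r + 1) p.2 p.1.1 (p.1.1 + p.2 • p.1.2)) ∧
      ∀ v, ‖v - p.1.2‖ < ρ → SolvesInverse L (r + 1) p.2 p.1.1 (p.1.1 + p.2 • p.1.2) v →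
        v = initVel L (r + 1) p.2 p.1.1 (p.1.1 + p.2 • p.1.2))
    (fun {ρ ρ' C C' p} hρ hC h => ⟨h.1.trans (by gcongr), h.2.1,
      fun v hv => h.2.2 v (hv.trans_le hρ)⟩)
    (fun x hx => by
      obtain ⟨V, hV⟩ := exists_isInverseVel (hL.regularAt hQ (hKQ hx).1) r
      obtain ⟨ρ, hρ, h⟩ := hV.eventually_initVel_eq
      obtain ⟨C, hC⟩ := hV.sub_isBigO.bound
      refine ⟨ρ, hρ, C, ?_⟩
      filter_upwards [h, hC] with p hp hpC hp0
      obtain ⟨h1, h2, h3⟩ := hp hp0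
      rw [h1]
      exact ⟨hpC, h2, h3⟩)
  -- the bound `h₀ ≤ ρ / C` keeps the solution, at distance at most `C |h|`, in the `ρ`-ball
  refine ⟨ρ, hρ, min h₀ (ρ / C), lt_min hh₀ (div_pos hρ hC), fun τ hτ hτ' x hx v => ?_⟩
  obtain ⟨h1, h2, h3⟩ := h x hx τ hτ (hτ'.trans_le (min_le_left _ _))
  refine ⟨fun hv => h3 v hv.1 hv.2, fun hv => ?_⟩
  subst hv
  refine ⟨h1.trans_lt ?_, h2⟩
  have := hτ'.trans_le (min_le_right _ _)
  rw [lt_div_iff₀ hC] at this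
  linarith [mul_comm C |τ|]

end InverseProblem

/-! ### The first variation of the action along Taylor approximations -/

lemma isBigO_clm_comp {P A B C : Type*} [NormedAddCommGroup A] [NormedSpace ℝ A]
    [NormedAddCommGroup B] [NormedSpace ℝ B] [NormedAddCommGroup C] [NormedSpace ℝ C]
    {l : Filter P} {f : P → B →L[ℝ] C} {g : P → A →L[ℝ] B} {u v : P → ℝ}
    (hf : f =O[l] u) (hg : g =O[l] v) : (fun p => (f p).comp (g p)) =O[l] fun p => u p * v p := by
  refine IsBigO.trans (IsBigO.of_bound 1 (Eventually.of_forall fun p => ?_))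
    (hf.norm_left.mul hg.norm_left)
  simpa using ContinuousLinearMap.opNorm_comp_le (f p) (g p)

lemma isBigO_clm_comp_one {P A B C : Type*} [NormedAddCommGroup A] [NormedSpace ℝ A]
    [NormedAddCommGroup B] [NormedSpace ℝ B] [NormedAddCommGroup C] [NormedSpace ℝ C]
    {l : Filter P} {f : P → B →L[ℝ] C} {g : P → A →L[ℝ] B} {u : P → ℝ}
    (hf : f =O[l] u) (hg : g =O[l] fun _ => (1 : ℝ)) : (fun p => (f p).comp (g p)) =O[l] u := by
  simpa using isBigO_clm_comp hf hg

lemma isBigO_one_clm_comp {P A B C : Type*} [NormedAddCommGroup A] [NormedSpace ℝ A]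
    [NormedAddCommGroup B] [NormedSpace ℝ B] [NormedAddCommGroup C] [NormedSpace ℝ C]
    {l : Filter P} {f : P → B →L[ℝ] C} {g : P → A →L[ℝ] B} {u : P → ℝ}
    (hf : f =O[l] fun _ => (1 : ℝ)) (hg : g =O[l] u) : (fun p => (f p).comp (g p)) =O[l] u := by
  simpa using isBigO_clm_comp hf hg

lemma isBigO_one_clm_apply {P A B : Type*} [NormedAddCommGroup A] [NormedSpace ℝ A]
    [NormedAddCommGroup B] [NormedSpace ℝ B] {l : Filter P} {f : P → A →L[ℝ] B} {g : P → A}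
    {u : P → ℝ} (hf : f =O[l] fun _ => (1 : ℝ)) (hg : g =O[l] u) :
    (fun p => f p (g p)) =O[l] u := by
  have h1 := hf.norm_left.mul hg.norm_left
  simp only [one_mul] at h1
  refine IsBigO.trans (IsBigO.of_bound 1 (Eventually.of_forall fun p => ?_)) h1
  simpa using (f p).le_opNorm (g p)

lemma isBigO_one_of_contDiffAt {A G : Type*} [NormedAddCommGroup A] [NormedSpace ℝ A]
    [NormedAddCommGroup G] [NormedSpace ℝ G] {x₀ : A} {f : A → G}
    (hf : ContDiffAt ℝ ∞ f x₀) : f =O[𝓝 x₀] fun _ => (1 : ℝ) :=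
  hf.continuousAt.tendsto.isBigO_one ℝ

section Derivatives

variable {F : Type*} [NormedAddCommGroup F] [NormedSpace ℝ F]
  {G : Type*} [NormedAddCommGroup G] [NormedSpace ℝ G]

lemma derivH_eq_of_hasDerivAt {f : F × ℝ → G} {p : F × ℝ} {y : G} (hf : DifferentiableAt ℝ f p)
    (h : HasDerivAt (fun t => f (p.1, t)) y p.2) : derivH f p = y :=
  (hasDerivAt_derivH hf).unique h

lemma eventually_derivX_congr {x₀ : F} {f g : F × ℝ → G} (h : f =ᶠ[𝓝 (x₀, 0)] g) :
    derivX f =ᶠ[𝓝 (x₀, 0)] derivX g := by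
  filter_upwards [h.fderiv (𝕜 := ℝ)] with p hp
  rw [derivX, hp, derivX]

lemma isBigO_derivX_sub {x₀ : F} {f g : F × ℝ → G} (hf : ContDiffAt ℝ ∞ f (x₀, 0))
    (hg : ContDiffAt ℝ ∞ g (x₀, 0)) {n : ℕ}
    (h : (fun p => f p - g p) =O[𝓝 (x₀, 0)] fun p => p.2 ^ n) :
    (fun p => derivX f p - derivX g p) =O[𝓝 (x₀, 0)] fun p => p.2 ^ n := by
  refine (isBigO_derivX n (hf.sub hg) h).congr' ?_ EventuallyEq.rfl
  filter_upwards [eventually_differentiableAt hf, eventually_differentiableAt hg] with p hp hq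
  have : fderiv ℝ (fun p => f p - g p) p = _ := fderiv_fun_sub hp hq
  change (fderiv ℝ (fun p => f p - g p) p).comp _ = _
  rw [this, ContinuousLinearMap.sub_comp, derivX, derivX]

lemma eventually_derivH_smul_lieMean {X : F → F} {φ : F → G} {x₀ : F} (hX : ContDiffAt ℝ ∞ X x₀)
    (hφ : ContDiffAt ℝ ∞ φ x₀) (n : ℕ) :
    ∀ᶠ p in 𝓝 (x₀, (0 : ℝ)), derivH (fun p : F × ℝ => p.2 • lieMean X φ n p.2 p.1) p =
      lieTaylor X φ n p.2 p.1 := by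
  filter_upwards [eventually_differentiableAt
    (contDiffAt_snd.smul (contDiffAt_lieMean hX hφ n 0))] with p hp
  exact derivH_eq_of_hasDerivAt hp (hasDerivAt_smul_lieMean X φ n p.2 p.1)

end Derivatives

section Variation

variable {E : Type*} [NormedAddCommGroup E] [NormedSpace ℝ E] [CompleteSpace E]
  {L : E × E → ℝ} {x₀ : E × E}

namespace RegularAt

lemma taylorMap (hx : RegularAt L x₀) (n : ℕ) (h : ℝ) :
    ContDiffAt ℝ ∞ (fun p : (E × E) × ℝ => taylorMap L n p.2 p.1) (x₀, h) := by
  simp only [taylorMap_eq]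
  exact (contDiffAt_lieTaylor hx.elField contDiffAt_fst _ h).prodMk
    (contDiffAt_lieTaylor hx.elField contDiffAt_snd _ h)

lemma tendsto_taylorMap (hx : RegularAt L x₀) (n : ℕ) :
    Tendsto (fun p : (E × E) × ℝ => TaylorVI.taylorMap L n p.2 p.1) (𝓝 (x₀, 0)) (𝓝 x₀) := by
  simpa [ContinuousAt, taylorMap_zero] using (hx.taylorMap n 0).continuousAt

/-- The Taylor method of order `n`, started on the exact solution at time `β h`, is accurate to
order `n + 1` at time `α h`. -/
lemma flow_sub_taylorMap (hx : RegularAt L x₀) {ϕ : (E × E) × ℝ → E × E}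
    (hϕ : IsLocalFlow (TaylorVI.elField L) x₀ ϕ) (n : ℕ) (α β : ℝ) :
    (fun p : (E × E) × ℝ => ϕ (p.1, α * p.2) -
      TaylorVI.taylorMap L n ((α - β) * p.2) (ϕ (p.1, β * p.2)))
      =O[𝓝 (x₀, 0)] fun p => p.2 ^ (n + 1) := by
  simp only [taylorMap_eq]
  exact (hϕ.taylor hx.elField contDiffAt_fst (n + 1) α β).prod_left
    (hϕ.taylor hx.elField contDiffAt_snd (n + 1) α β)

lemma flow_sub_taylorMap_zero (hx : RegularAt L x₀) {ϕ : (E × E) × ℝ → E × E}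
    (hϕ : IsLocalFlow (TaylorVI.elField L) x₀ ϕ) (n : ℕ) (α : ℝ) :
    (fun p : (E × E) × ℝ => ϕ (p.1, α * p.2) - TaylorVI.taylorMap L n (α * p.2) p.1)
      =O[𝓝 (x₀, 0)] fun p => p.2 ^ (n + 1) := by
  simp only [taylorMap_eq]
  exact (hϕ.taylor_zero hx.elField contDiffAt_fst (n + 1) α).prod_left
    (hϕ.taylor_zero hx.elField contDiffAt_snd (n + 1) α)

lemma flow_sub_taylorMap_one (hx : RegularAt L x₀) {ϕ : (E × E) × ℝ → E × E}
    (hϕ : IsLocalFlow (TaylorVI.elField L) x₀ ϕ) (n : ℕ) :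
    (fun p : (E × E) × ℝ => ϕ p - TaylorVI.taylorMap L n p.2 p.1)
      =O[𝓝 (x₀, 0)] fun p => p.2 ^ (n + 1) := by
  simpa using hx.flow_sub_taylorMap_zero hϕ n 1

/-- A Lie series agrees with the function evaluated at the Taylor approximation, since both
approximate the function along the exact flow. -/
lemma lieTaylor_sub_comp_taylorMap (hx : RegularAt L x₀) {G : Type*} [NormedAddCommGroup G]
    [NormedSpace ℝ G] {φ : E × E → G} (hφ : ContDiffAt ℝ ∞ φ x₀) {m n : ℕ} (hmn : m ≤ n + 1) :
    (fun p : (E × E) × ℝ => lieTaylor (TaylorVI.elField L) φ m p.2 p.1 -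
      φ (TaylorVI.taylorMap L n p.2 p.1)) =O[𝓝 (x₀, 0)] fun p => p.2 ^ m := by
  obtain ⟨ϕ, hϕ⟩ := exists_isLocalFlow hx.elField
  have h1 := hϕ.taylor_zero hx.elField hφ m 1
  simp only [one_mul] at h1
  have h2 := (isBigO_comp_sub_comp hφ hϕ.tendsto (hx.tendsto_taylorMap n)).trans
    ((hx.flow_sub_taylorMap_one hϕ n).trans (isBigO_pow_of_le hmn))
  refine (h2.sub h1).congr_left fun p => ?_
  abel

/-- The Taylor approximation satisfies the Euler--Lagrange equation up to `O(h^n)`. -/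
lemma derivH_taylorMap (hx : RegularAt L x₀) (n : ℕ) :
    (fun p => derivH (fun p : (E × E) × ℝ => TaylorVI.taylorMap L n p.2 p.1) p -
      TaylorVI.elField L (TaylorVI.taylorMap L n p.2 p.1)) =O[𝓝 (x₀, 0)] fun p => p.2 ^ n := by
  have hφ : ContDiffAt ℝ ∞ (lieIter (TaylorVI.elField L) (Prod.snd : E × E → E) 1) x₀ :=
    contDiffAt_lieIter hx.elField contDiffAt_snd 1
  have hsnd : lieIter (TaylorVI.elField L) (Prod.snd : E × E → E) 1
      = fun x => (TaylorVI.elField L x).2 := by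
    funext x
    change fderiv ℝ Prod.snd x (TaylorVI.elField L x) = _
    rw [fderiv_snd]; rfl
  have h1 := (hx.lieTaylor_sub_comp_taylorMap (φ := Prod.snd) contDiffAt_snd n.le_succ).prod_left
    (hx.lieTaylor_sub_comp_taylorMap hφ n.le_succ)
  refine h1.congr' ?_ EventuallyEq.rfl
  filter_upwards [eventually_differentiableAt (hx.taylorMap n 0)] with p hp
  have h2 : derivH (fun p : (E × E) × ℝ => TaylorVI.taylorMap L n p.2 p.1) p =
      (lieTaylor (TaylorVI.elField L) (lieIter (TaylorVI.elField L) Prod.fst 1) n p.2 p.1,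
        lieTaylor (TaylorVI.elField L) (lieIter (TaylorVI.elField L) Prod.snd 1) n p.2 p.1) := by
    refine derivH_eq_of_hasDerivAt hp ?_
    simp only [taylorMap_eq]
    exact (hasDerivAt_lieTaylor (TaylorVI.elField L) Prod.fst n p.2 p.1).prodMk
      (hasDerivAt_lieTaylor (TaylorVI.elField L) Prod.snd n p.2 p.1)
  rw [h2, lieIter_fst_one, hsnd]
  rfl

/-- The first variation formula: the derivative of the action in the initial data is the
boundary term of the momenta, up to the order of the Taylor approximation. -/
lemma derivX_action (hx : RegularAt L x₀) (n : ℕ) :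
    (fun p => derivX (fun p : (E × E) × ℝ => p.2 • lieMean (TaylorVI.elField L) L n p.2 p.1) p -
        (TaylorVI.momentum L (TaylorVI.taylorMap L n p.2 p.1)).comp
          (derivX (fun p : (E × E) × ℝ => (TaylorVI.taylorMap L n p.2 p.1).1) p) +
        (TaylorVI.momentum L p.1).comp (ContinuousLinearMap.fst ℝ E E))
      =O[𝓝 (x₀, 0)] fun p => p.2 ^ (n + 1) := by
  set Γ : (E × E) × ℝ → E × E := fun p => TaylorVI.taylorMap L n p.2 p.1 with hΓdef
  set I : (E × E) × ℝ → ℝ := fun p => p.2 • lieMean (TaylorVI.elField L) L n p.2 p.1 with hI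
  set p₀ : (E × E) × ℝ := (x₀, 0)
  have hΓ : ContDiffAt ℝ ∞ Γ p₀ := hx.taylorMap n 0
  have hΓ0 : Γ p₀ = x₀ := taylorMap_zero L n x₀
  have hΓt : Tendsto Γ (𝓝 p₀) (𝓝 x₀) := hx.tendsto_taylorMap n
  have hΓ1 : ContDiffAt ℝ ∞ (fun p => (Γ p).1) p₀ := contDiffAt_fst.comp p₀ hΓ
  have hΓ2 : ContDiffAt ℝ ∞ (fun p => (Γ p).2) p₀ := contDiffAt_snd.comp p₀ hΓ
  have hIs : ContDiffAt ℝ ∞ I p₀ :=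
    contDiffAt_snd.smul (contDiffAt_lieMean hx.elField hx.contDiffAt n 0)
  have hm : ContDiffAt ℝ ∞ (TaylorVI.momentum L) (Γ p₀) := hΓ0 ▸ hx.momentum
  have hLΓ : ContDiffAt ℝ ∞ (fun p => L (Γ p)) p₀ :=
    ContDiffAt.comp p₀ (hΓ0 ▸ hx.contDiffAt : ContDiffAt ℝ ∞ L (Γ p₀)) hΓ
  have hmΓ : ContDiffAt ℝ ∞ (fun p => TaylorVI.momentum L (Γ p)) p₀ := ContDiffAt.comp p₀ hm hΓ
  have hm1 : ContDiffAt ℝ ∞ (fun p : (E × E) × ℝ => TaylorVI.momentum L p.1) p₀ :=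
    ContDiffAt.comp p₀ hx.momentum contDiffAt_fst
  refine isBigO_of_isBigO_derivH (((contDiffAt_derivX hIs).sub
    (hmΓ.clm_comp (contDiffAt_derivX hΓ1))).add (hm1.clm_comp contDiffAt_const)) ?_ ?_
  · have hz := (Continuous.prodMk_left (0 : ℝ)).tendsto x₀
    filter_upwards [hz.eventually (eventually_differentiableAt hIs),
      hz.eventually (eventually_differentiableAt hΓ1)] with x h1 h2
    rw [derivX_eq h1, derivX_eq h2]
    simp only [hI, hΓdef, zero_smul, taylorMap_zero]
    have h3 : fderiv ℝ (fun x : E × E => x.1) x = ContinuousLinearMap.fst ℝ E E := fderiv_fst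
    rw [h3, fderiv_fun_const]
    simp
  · -- The derivative of the defect in `h` consists of three terms of order `h^n`.
    have ha : (fun p => derivX (derivH I) p - derivX (fun p => L (Γ p)) p)
        =O[𝓝 p₀] fun p => p.2 ^ n := by
      have h1 := isBigO_derivX_sub (contDiffAt_lieTaylor hx.elField hx.contDiffAt n 0) hLΓ
        (hx.lieTaylor_sub_comp_taylorMap hx.contDiffAt n.le_succ)
      refine h1.congr' ?_ EventuallyEq.rfl
      filter_upwards [eventually_derivX_congr (eventually_derivH_smul_lieMean hx.elField
        hx.contDiffAt n)] with p hp
      rw [← hp]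
    have hb : (fun p => TaylorVI.partialQ L (Γ p) - derivH (fun p => TaylorVI.momentum L (Γ p)) p)
        =O[𝓝 p₀] fun p => p.2 ^ n := by
      have h1 : (fun p => fderiv ℝ (TaylorVI.momentum L) (Γ p)) =O[𝓝 p₀] fun _ => (1 : ℝ) :=
        (isBigO_one_of_contDiffAt (hx.momentum.fderiv_right (m := ∞) (by simp))).comp_tendsto hΓt
      have h2 : (fun p => fderiv ℝ (TaylorVI.momentum L) (Γ p)
          (derivH Γ p - TaylorVI.elField L (Γ p))) =O[𝓝 p₀] fun p => p.2 ^ n := by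
        exact isBigO_one_clm_apply h1 (hx.derivH_taylorMap n)
      refine h2.neg_left.congr' ?_ EventuallyEq.rfl
      have hreg : ∀ᶠ x in 𝓝 x₀, fderiv ℝ (TaylorVI.momentum L) x (TaylorVI.elField L x)
          = TaylorVI.partialQ L x := by
        filter_upwards [eventually_differentiableAt hx.momentum, hx.eventually_isInvertible]
          with x h3 h4 using fderiv_momentum_elField h3 h4
      filter_upwards [hΓt.eventually hreg, hΓt.eventually (eventually_differentiableAt hx.momentum),
        eventually_differentiableAt hΓ] with p h3 h4 h5
      have h6 : fderiv ℝ (fun p => TaylorVI.momentum L (Γ p)) p = _ := fderiv_comp p h4 h5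
      rw [map_sub, h3, derivH, derivH, h6]
      simp
    have hc : (fun p => derivX (fun p => (Γ p).2) p - derivX (derivH (fun p => (Γ p).1)) p)
        =O[𝓝 p₀] fun p => p.2 ^ n := by
      refine isBigO_derivX_sub hΓ2 (contDiffAt_derivH hΓ1) ?_
      refine (hx.derivH_taylorMap n).neg_left.prod_left_fst.congr' ?_ EventuallyEq.rfl
      filter_upwards [eventually_differentiableAt hΓ] with p hp
      have : fderiv ℝ (fun p => (Γ p).1) p = _ :=
        (hasFDerivAt_fst.comp p hp.hasFDerivAt).fderiv
      change -((fderiv ℝ Γ p (0, 1)).1 - (Γ p).2) = (Γ p).2 - fderiv ℝ (fun p => (Γ p).1) p (0, 1)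
      rw [this]
      simp
    have hdX1 : derivX (fun p => (Γ p).1) =O[𝓝 p₀] fun _ => (1 : ℝ) :=
      isBigO_one_of_contDiffAt (contDiffAt_derivX hΓ1)
    have hmO : (fun p => TaylorVI.momentum L (Γ p)) =O[𝓝 p₀] fun _ => (1 : ℝ) :=
      isBigO_one_of_contDiffAt hmΓ
    have hsum := (ha.add (isBigO_clm_comp_one hb hdX1)).add (isBigO_one_clm_comp hmO hc)
    refine hsum.congr' ?_ EventuallyEq.rfl
    filter_upwards [eventually_derivH_derivX hIs, eventually_derivH_derivX hΓ1,
      eventually_differentiableAt (contDiffAt_derivX hIs),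
      eventually_differentiableAt (contDiffAt_derivX hΓ1), eventually_differentiableAt hmΓ,
      eventually_differentiableAt hΓ, hΓt.eventually (eventually_differentiableAt hx.contDiffAt),
      eventually_differentiableAt hm1]
      with p h1 h2 h3 h4 h5 h6 h7 h8
    -- the chain rule for `L ∘ Γ`
    have e1 : derivX (fun p => L (Γ p)) p =
        (TaylorVI.partialQ L (Γ p)).comp (derivX (fun p => (Γ p).1) p) +
          (TaylorVI.momentum L (Γ p)).comp (derivX (fun p => (Γ p).2) p) := by
      have f0 : fderiv ℝ (fun p => L (Γ p)) p = _ := fderiv_comp p h7 h6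
      have f1 : fderiv ℝ (fun p => (Γ p).1) p = _ :=
        (hasFDerivAt_fst.comp p h6.hasFDerivAt).fderiv
      have f2 : fderiv ℝ (fun p => (Γ p).2) p = _ :=
        (hasFDerivAt_snd.comp p h6.hasFDerivAt).fderiv
      have f3 : TaylorVI.partialQ L (Γ p) = _ := fderiv_partial_left h7
      have f4 : TaylorVI.momentum L (Γ p) = _ := fderiv_partial_right h7
      refine ContinuousLinearMap.ext fun ξ => ?_
      simp only [derivX, f0, f1, f2, f3, f4, ContinuousLinearMap.comp_apply,
        add_apply, ← map_add]
      congr 1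
      simp
    -- the product rule for the boundary term
    have e2 : derivH (fun p => derivX I p - (TaylorVI.momentum L (Γ p)).comp
          (derivX (fun p => (Γ p).1) p) +
          (TaylorVI.momentum L p.1).comp (ContinuousLinearMap.fst ℝ E E)) p =
        derivH (derivX I) p - ((TaylorVI.momentum L (Γ p)).comp
            (derivH (derivX (fun p => (Γ p).1)) p) +
          (derivH (fun p => TaylorVI.momentum L (Γ p)) p).comp (derivX (fun p => (Γ p).1) p)) := by
      have g1 := hasDerivAt_derivH h3
      have g2 := (hasDerivAt_derivH h5).clm_comp (hasDerivAt_derivH h4)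
      have g3 := hasDerivAt_const p.2
        ((TaylorVI.momentum L p.1).comp (ContinuousLinearMap.fst ℝ E E))
      refine derivH_eq_of_hasDerivAt ((h3.sub (h5.clm_comp h4)).add
        (h8.clm_comp (differentiableAt_const _))) ?_
      refine ((g1.sub g2).add g3).congr_deriv ?_
      rw [add_zero]; congr 1; exact add_comm _ _
    rw [e2, h1, h2, e1]
    refine ContinuousLinearMap.ext fun ξ => ?_
    simp
    ring

end RegularAt

end Variation

/-! ### The discrete Lagrangian divided by the step size -/

section ScaledLagrangian

variable {E : Type*} [NormedAddCommGroup E] [NormedSpace ℝ E]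

/-- Exchange of the two end points: a step of size `h` with difference quotient `w` starting at
`q` is a step of size `-h` with the same difference quotient starting at `q + h w`. -/
def swapEnds (p : (E × E) × ℝ) : (E × E) × ℝ := ((p.1.1 + p.2 • p.1.2, p.1.2), -p.2)

lemma swapEnds_swapEnds (p : (E × E) × ℝ) : swapEnds (swapEnds p) = p := by
  simp [swapEnds]

lemma contDiff_swapEnds : ContDiff ℝ ∞ (swapEnds : (E × E) × ℝ → (E × E) × ℝ) := by
  unfold swapEnds
  fun_prop

lemma swapEnds_zero (x : E × E) : swapEnds (x, (0 : ℝ)) = (x, 0) := by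
  simp [swapEnds]

lemma tendsto_swapEnds (x₀ : E × E) : Tendsto swapEnds (𝓝 (x₀, (0 : ℝ))) (𝓝 (x₀, 0)) := by
  simpa [swapEnds_zero] using contDiff_swapEnds.continuous.tendsto (x₀, (0 : ℝ))

/-- The node value `(q_c, v_c)` in the variables `((q, w), h)`, where `q` and `q + h w` are the end
points and `V` solves the inverse problem. Unlike `nodeValue`, it makes sense at `h = 0`. -/
def scaledNode (L : E × E → ℝ) (r : ℕ) (V : (E × E) × ℝ → E) (c : ℝ) (p : (E × E) × ℝ) : E × E :=
  if c = 0 then (p.1.1, V p)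
  else if c = 1 then ((swapEnds p).1.1, V (swapEnds p))
  else
    (c • (taylorMap L r (c * p.2) (p.1.1, V p)).1
        + (1 - c) • (taylorMap L r ((1 - c) * (swapEnds p).2) ((swapEnds p).1.1, V (swapEnds p))).1,
     c • (taylorMap L (r - 1) (c * p.2) (p.1.1, V p)).2
        + (1 - c) •
          (taylorMap L (r - 1) ((1 - c) * (swapEnds p).2) ((swapEnds p).1.1, V (swapEnds p))).2)

/-- The discrete Lagrangian divided by the step size, `L_d (q, q + h w; h) / h`, as a function of
`((q, w), h)`; it is smooth across `h = 0`. -/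
def scaledLagrangian (L : E × E → ℝ) (r : ℕ) {m : ℕ} (b c : Fin m → ℝ) (V : (E × E) × ℝ → E)
    (p : (E × E) × ℝ) : ℝ :=
  ∑ i, b i * L (scaledNode L r V (c i) p)

lemma scaledNode_swapEnds (L : E × E → ℝ) (r : ℕ) (V : (E × E) × ℝ → E) (c : ℝ)
    (p : (E × E) × ℝ) : scaledNode L r V (1 - c) (swapEnds p) = scaledNode L r V c p := by
  unfold scaledNode
  simp only [swapEnds_swapEnds]
  by_cases h0 : c = 0
  · simp [h0]
  by_cases h1 : c = 1
  · simp [h1]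
  have h2 : 1 - c ≠ 0 := sub_ne_zero.2 (Ne.symm h1)
  have h3 : 1 - c ≠ 1 := by simpa using h0
  rw [if_neg h0, if_neg h1, if_neg h2, if_neg h3, sub_sub_cancel]
  exact Prod.ext (add_comm _ _) (add_comm _ _)

/-- The discrete Lagrangian of a symmetric rule is symmetric. -/
lemma scaledLagrangian_swapEnds (L : E × E → ℝ) (r : ℕ) {m : ℕ} {b c : Fin m → ℝ}
    (hbc : QuadratureSymmetric b c) (V : (E × E) × ℝ → E) (p : (E × E) × ℝ) :
    scaledLagrangian L r b c V (swapEnds p) = scaledLagrangian L r b c V p := by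
  unfold scaledLagrangian
  rw [← Equiv.sum_comp Fin.revPerm]
  refine Finset.sum_congr rfl fun i _ => ?_
  have h1 : c i.rev = 1 - c i := by rw [(hbc i).1]; ring
  rw [Fin.revPerm_apply, ← (hbc i).2, h1, scaledNode_swapEnds]

lemma eventually_discreteLagrangian_eq {L : E × E → ℝ} {r : ℕ} {x₀ : E × E}
    {V : (E × E) × ℝ → E} (hV : IsInverseVel L (r + 1) x₀ V) {m : ℕ} (b c : Fin m → ℝ) :
    ∀ᶠ p in 𝓝 (x₀, (0 : ℝ)), p.2 ≠ 0 →
      discreteLagrangian L (r + 1) b c p.2 p.1.1 (p.1.1 + p.2 • p.1.2) =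
        p.2 * scaledLagrangian L (r + 1) b c V p := by
  obtain ⟨ρ, -, h⟩ := hV.eventually_initVel_eq
  filter_upwards [h, (tendsto_swapEnds x₀).eventually h] with p hp hps hp0
  have h1 := (hp hp0).1
  have h2 := (hps (by simpa [swapEnds] using hp0)).1
  have h3 : (swapEnds p).1.1 + (swapEnds p).2 • (swapEnds p).1.2 = p.1.1 :=
    congrArg (fun p => p.1.1) (swapEnds_swapEnds p)
  rw [h3] at h2
  change initVel L (r + 1) (-p.2) (p.1.1 + p.2 • p.1.2) p.1.1 = _ at h2
  unfold discreteLagrangian scaledLagrangian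
  congr 1
  refine Finset.sum_congr rfl fun i _ => ?_
  simp only [nodeValue, scaledNode, h1, h2]
  simp only [swapEnds, mul_neg]

variable {L : E × E → ℝ} {r : ℕ} {x₀ : E × E} {V : (E × E) × ℝ → E}

lemma IsInverseVel.contDiffAt_leftEnd (hV : IsInverseVel L (r + 1) x₀ V) :
    ContDiffAt ℝ ∞ (fun p => (p.1.1, V p)) (x₀, (0 : ℝ)) :=
  (contDiffAt_fst.comp _ contDiffAt_fst).prodMk hV.contDiffAt

lemma IsInverseVel.tendsto_leftEnd (hV : IsInverseVel L (r + 1) x₀ V) :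
    Tendsto (fun p => (p.1.1, V p)) (𝓝 (x₀, (0 : ℝ))) (𝓝 x₀) :=
  ((continuous_fst.comp continuous_fst).tendsto (x₀, (0 : ℝ))).prodMk_nhds hV.tendsto

lemma contDiffAt_scaledNode [CompleteSpace E] (hx : RegularAt L x₀)
    (hV : IsInverseVel L (r + 1) x₀ V) (c : ℝ) :
    ContDiffAt ℝ ∞ (scaledNode L (r + 1) V c) (x₀, 0) := by
  have h0 := hV.contDiffAt_leftEnd
  have h1 : ContDiffAt ℝ ∞ (fun p => ((swapEnds p).1.1, V (swapEnds p))) (x₀, (0 : ℝ)) :=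
    ContDiffAt.comp (g := fun p => (p.1.1, V p)) (f := swapEnds) (x₀, (0 : ℝ))
      (by rw [swapEnds_zero]; exact h0) contDiff_swapEnds.contDiffAt
  have hv0 : V (x₀, 0) = x₀.2 := hV.eventually_zero.self_of_nhds
  have key : ∀ (s : ℕ) (d : ℝ) {g : (E × E) × ℝ → E × E} {t : (E × E) × ℝ → ℝ},
      ContDiffAt ℝ ∞ g (x₀, 0) → ContDiffAt ℝ ∞ t (x₀, 0) → g (x₀, 0) = x₀ → t (x₀, 0) = 0 →
      ContDiffAt ℝ ∞ (fun p => taylorMap L s (d * t p) (g p)) (x₀, 0) := by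
    intro s d g t hg ht hg0 ht0
    have h2 : ContDiffAt ℝ ∞ (fun p => (g p, d * t p)) (x₀, (0 : ℝ)) :=
      hg.prodMk (contDiffAt_const.mul ht)
    refine ContDiffAt.comp (g := fun p : (E × E) × ℝ => taylorMap L s p.2 p.1)
      (f := fun p => (g p, d * t p)) (x₀, (0 : ℝ)) ?_ h2
    simp only [hg0, ht0, mul_zero]
    exact hx.taylorMap s 0
  have hs : ContDiffAt ℝ ∞ (fun p : (E × E) × ℝ => (swapEnds p).2) (x₀, 0) :=
    (contDiff_snd.comp contDiff_swapEnds).contDiffAt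
  unfold scaledNode
  by_cases hc0 : c = 0
  · simpa [hc0] using h0
  by_cases hc1 : c = 1
  · simpa [hc1] using h1
  simp only [if_neg hc0, if_neg hc1]
  have kl : ∀ s, ContDiffAt ℝ ∞ (fun p => taylorMap L s (c * p.2) (p.1.1, V p)) (x₀, (0 : ℝ)) :=
    fun s => key s c h0 contDiffAt_snd (by simp [hv0]) rfl
  have kr : ∀ s, ContDiffAt ℝ ∞ (fun p => taylorMap L s ((1 - c) * (swapEnds p).2)
      ((swapEnds p).1.1, V (swapEnds p))) (x₀, (0 : ℝ)) :=
    fun s => key s (1 - c) h1 hs (by simp [swapEnds_zero, hv0]) (by simp [swapEnds_zero])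
  exact ((contDiffAt_const.smul (contDiffAt_fst.comp _ (kl _))).add
    (contDiffAt_const.smul (contDiffAt_fst.comp _ (kr _)))).prodMk
    ((contDiffAt_const.smul (contDiffAt_snd.comp _ (kl _))).add
    (contDiffAt_const.smul (contDiffAt_snd.comp _ (kr _))))

lemma eventually_scaledNode_zero (hV : IsInverseVel L (r + 1) x₀ V) (c : ℝ) :
    ∀ᶠ x in 𝓝 x₀, scaledNode L (r + 1) V c (x, 0) = x := by
  filter_upwards [hV.eventually_zero] with x hx
  unfold scaledNode
  simp only [swapEnds_zero, hx, mul_zero, taylorMap_zero, ← add_smul, add_sub_cancel, one_smul]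
  split_ifs <;> rfl

lemma scaledNode_zero (hV : IsInverseVel L (r + 1) x₀ V) (c : ℝ) :
    scaledNode L (r + 1) V c (x₀, 0) = x₀ :=
  (eventually_scaledNode_zero hV c).self_of_nhds

lemma contDiffAt_scaledLagrangian [CompleteSpace E] (hx : RegularAt L x₀)
    (hV : IsInverseVel L (r + 1) x₀ V) {m : ℕ} (b c : Fin m → ℝ) :
    ContDiffAt ℝ ∞ (scaledLagrangian L (r + 1) b c V) (x₀, 0) := by
  refine ContDiffAt.sum fun i _ => contDiffAt_const.mul ?_
  exact ContDiffAt.comp (x₀, (0 : ℝ)) (by rw [scaledNode_zero hV]; exact hx.contDiffAt)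
    (contDiffAt_scaledNode hx hV (c i))

lemma eventually_scaledLagrangian_zero (hV : IsInverseVel L (r + 1) x₀ V) {m : ℕ}
    {b : Fin m → ℝ} (hb : ∑ i, b i = 1) (c : Fin m → ℝ) :
    ∀ᶠ x in 𝓝 x₀, scaledLagrangian L (r + 1) b c V (x, 0) = L x := by
  have : ∀ᶠ x in 𝓝 x₀, ∀ i, scaledNode L (r + 1) V (c i) (x, 0) = x :=
    eventually_all.2 fun i => eventually_scaledNode_zero hV (c i)
  filter_upwards [this] with x hx
  simp [scaledLagrangian, hx, ← Finset.sum_mul, hb]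

end ScaledLagrangian

/-! ### The quadrature rule and the Taylor mean of the Lagrangian -/

section Quadrature

variable {F : Type*} [NormedAddCommGroup F] [NormedSpace ℝ F]

lemma QuadratureOrder.sum_mul_pow {m n : ℕ} {b c : Fin m → ℝ} (h : QuadratureOrder b c n) {k : ℕ}
    (hk : k < n) : ∑ i, b i * c i ^ k = 1 / ((k : ℝ) + 1) := by
  rw [h k hk, integral_pow]; simp

lemma QuadratureOrder.sum_lieTaylor {m n : ℕ} {b c : Fin m → ℝ} (h : QuadratureOrder b c n)
    (X : F → F) (φ : F → ℝ) (τ : ℝ) (x : F) :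
    ∑ i, b i * lieTaylor X φ n (c i * τ) x = lieMean X φ n τ x := by
  simp only [lieTaylor, lieMean, Finset.mul_sum]
  rw [Finset.sum_comm]
  refine Finset.sum_congr rfl fun k hk => ?_
  have h1 := h.sum_mul_pow (Finset.mem_range.1 hk)
  have h2 : ∀ i, b i * ((c i * τ) ^ k / (k.factorial : ℝ)) • lieIter X φ k x =
      (b i * c i ^ k) * (τ ^ k / (k.factorial : ℝ) * lieIter X φ k x) := by
    intro i; rw [smul_eq_mul, mul_pow]; ring
  have h3 : (k.factorial : ℝ) ≠ 0 := by positivity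
  have h4 : (k : ℝ) + 1 ≠ 0 := by positivity
  rw [Finset.sum_congr rfl fun i _ => h2 i, ← Finset.sum_mul, h1, smul_eq_mul, Nat.factorial_succ]
  push_cast
  field_simp

lemma QuadratureOrder.sum_lieTaylor_reverse {m n : ℕ} {b c : Fin m → ℝ}
    (h : QuadratureOrder b c n) (hbc : QuadratureSymmetric b c)
    (X : F → F) (φ : F → ℝ) (τ : ℝ) (x : F) :
    ∑ i, b i * lieTaylor X φ n ((c i - 1) * τ) x = lieMean X φ n (-τ) x := by
  rw [← h.sum_lieTaylor, ← Equiv.sum_comp Fin.revPerm]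
  refine Finset.sum_congr rfl fun i _ => ?_
  rw [Fin.revPerm_apply, ← (hbc i).2]
  congr 2
  rw [(hbc i).1]; ring

end Quadrature

/-! ### Accuracy of the discrete Lagrangian -/

section Parity

variable {F : Type*} [NormedAddCommGroup F] [NormedSpace ℝ F]
  {G : Type*} [NormedAddCommGroup G] [NormedSpace ℝ G]

/-- A function of odd order `r` in `h` that is symmetric up to `O(h^(r+1))` under
`(x, h) ↦ (Γ (x, h), -h)` is `O(h^(r+1))`: its leading coefficient at `h^r` would have to change
sign. -/
lemma isBigO_succ_of_symmetric {x₀ : F} {f : F × ℝ → G} (hf : ContDiffAt ℝ ∞ f (x₀, 0)) {r : ℕ}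
    (hr : Odd r) (h : f =O[𝓝 (x₀, 0)] fun p => p.2 ^ r) {Γ : F × ℝ → F}
    (hΓ : Tendsto Γ (𝓝 (x₀, 0)) (𝓝 x₀))
    (hΓ1 : (fun p => Γ p - p.1) =O[𝓝 (x₀, 0)] fun p => p.2)
    (hs : (fun p => f (Γ p, -p.2) - f p) =O[𝓝 (x₀, 0)] fun p => p.2 ^ (r + 1)) :
    f =O[𝓝 (x₀, 0)] fun p => p.2 ^ (r + 1) := by
  set a : F → G := fun x =>
    (1 / (r.factorial : ℝ)) • lieIter (fun _ => ((0 : F), (1 : ℝ))) f r (x, 0) with ha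
  have has : ContDiffAt ℝ ∞ a x₀ := by
    refine contDiffAt_const.smul ?_
    exact ContDiffAt.comp (g := lieIter (fun _ => ((0 : F), (1 : ℝ))) f r)
      (f := fun x : F => (x, (0 : ℝ))) x₀ (contDiffAt_lieIter contDiffAt_const hf r)
      (contDiffAt_id.prodMk contDiffAt_const)
  have hlead : (fun p : F × ℝ => f p - p.2 ^ r • a p.1) =O[𝓝 (x₀, 0)] fun p => p.2 ^ (r + 1) := by
    refine (isBigO_sub_lieTaylor_const hf (r + 1)).congr' ?_ EventuallyEq.rfl
    filter_upwards [(continuous_fst.tendsto (x₀, (0 : ℝ))).eventually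
      (eventually_lieIter_const_eq_zero hf h)] with p hp
    rw [lieTaylor, Finset.sum_range_succ, Finset.sum_eq_zero, zero_add, ha]
    · simp [smul_smul, div_eq_mul_inv]
    · intro k hk
      rw [hp k (Finset.mem_range.1 hk), smul_zero]
  have hrev : Tendsto (fun p : F × ℝ => (Γ p, -p.2)) (𝓝 (x₀, 0)) (𝓝 (x₀, 0)) :=
    tendsto_prodMk_neg hΓ
  have hlead' : (fun p : F × ℝ => f (Γ p, -p.2) + p.2 ^ r • a (Γ p)) =O[𝓝 (x₀, 0)]
      fun p => p.2 ^ (r + 1) := by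
    refine (hlead.comp_tendsto hrev).congr' ?_ ?_
    · refine Eventually.of_forall fun p => ?_
      simp [hr.neg_pow]
    · refine Eventually.of_forall fun p => ?_
      simp [hr.add_one.neg_pow]
  have hdiff : (fun p : F × ℝ => p.2 ^ r • (a (Γ p) - a p.1)) =O[𝓝 (x₀, 0)]
      fun p => p.2 ^ (r + 1) := by
    have h1 : (fun p : F × ℝ => a (Γ p) - a p.1) =O[𝓝 (x₀, 0)] fun p => p.2 :=
      (isBigO_comp_sub_comp has hΓ (continuous_fst.tendsto (x₀, (0 : ℝ)))).trans hΓ1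
    simpa [pow_succ] using (isBigO_refl (fun p : F × ℝ => p.2 ^ r) (𝓝 (x₀, 0))).smul h1
  have h2 : (fun p : F × ℝ => (2 : ℝ) • f p) =O[𝓝 (x₀, 0)] fun p => p.2 ^ (r + 1) := by
    refine (((hlead.add hlead').sub hs).sub hdiff).congr_left fun p => ?_
    rw [smul_sub, two_smul]; abel
  refine (h2.const_smul_left (1 / 2 : ℝ)).congr_left fun p => ?_
  simp [smul_smul]

end Parity

section Accuracy

variable {E : Type*} [NormedAddCommGroup E] [NormedSpace ℝ E]

lemma lieMean_succ_sub_isBigO {X : E × E → E × E} {G : Type*} [NormedAddCommGroup G]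
    [NormedSpace ℝ G] {φ : E × E → G} {x₀ : E × E}
    (hX : ContDiffAt ℝ ∞ X x₀) (hφ : ContDiffAt ℝ ∞ φ x₀) (n : ℕ) :
    (fun p : (E × E) × ℝ => lieMean X φ (n + 1) p.2 p.1 - lieMean X φ n p.2 p.1)
      =O[𝓝 (x₀, 0)] fun p => p.2 ^ n := by
  have h1 : (fun p : (E × E) × ℝ => (1 / ((n + 1).factorial : ℝ)) • lieIter X φ n p.1)
      =O[𝓝 (x₀, 0)] fun _ => (1 : ℝ) :=
    isBigO_one_of_contDiffAt (x₀ := (x₀, (0 : ℝ)))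
      (contDiffAt_const.smul ((contDiffAt_lieIter hX hφ n).comp (x₀, (0 : ℝ)) contDiffAt_fst))
  have h2 := (isBigO_refl (fun p : (E × E) × ℝ => p.2 ^ n) (𝓝 (x₀, 0))).smul h1
  simp only [smul_eq_mul, mul_one] at h2
  refine h2.congr_left fun p => ?_
  simp [lieMean, Finset.sum_range_succ, smul_smul, div_eq_mul_inv]

/-- The map `((q, v), h) ↦ ((q, w), h)`, where `h w` is the displacement of the Taylor method of
order `n`. -/
def displacementMap (L : E × E → ℝ) (n : ℕ) (p : (E × E) × ℝ) : (E × E) × ℝ :=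
  ((p.1.1, lieMean (elField L) Prod.snd n p.2 p.1), p.2)

lemma displacementMap_zero (L : E × E → ℝ) (n : ℕ) (x : E × E) :
    displacementMap L (n + 1) (x, 0) = (x, 0) := by
  simp [displacementMap, lieMean_zero_right]

lemma swapEnds_displacementMap (L : E × E → ℝ) (n : ℕ) (p : (E × E) × ℝ) :
    swapEnds (displacementMap L n p) =
      (((taylorMap L n p.2 p.1).1, lieMean (elField L) Prod.snd n p.2 p.1), -p.2) := by
  rw [swapEnds, taylorMap_fst_eq]; rfl

variable [CompleteSpace E] {L : E × E → ℝ} {x₀ : E × E}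

lemma contDiffAt_displacementMap (hx : RegularAt L x₀) (n : ℕ) :
    ContDiffAt ℝ ∞ (displacementMap L n) (x₀, 0) :=
  ((contDiffAt_fst.comp _ contDiffAt_fst).prodMk
    (contDiffAt_lieMean hx.elField contDiffAt_snd n 0)).prodMk contDiffAt_snd

lemma tendsto_displacementMap (hx : RegularAt L x₀) (n : ℕ) :
    Tendsto (displacementMap L (n + 1)) (𝓝 (x₀, 0)) (𝓝 (x₀, 0)) := by
  have := (contDiffAt_displacementMap hx (n + 1)).continuousAt.tendsto
  rwa [displacementMap_zero] at this

lemma tendsto_reverse (hx : RegularAt L x₀) (n : ℕ) :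
    Tendsto (fun p : (E × E) × ℝ => (taylorMap L n p.2 p.1, -p.2)) (𝓝 (x₀, 0)) (𝓝 (x₀, 0)) :=
  tendsto_prodMk_neg (hx.tendsto_taylorMap n)

lemma contDiffAt_reverse (hx : RegularAt L x₀) (n : ℕ) :
    ContDiffAt ℝ ∞ (fun p : (E × E) × ℝ => (taylorMap L n p.2 p.1, -p.2)) (x₀, 0) :=
  (hx.taylorMap n 0).prodMk contDiffAt_snd.neg

lemma taylorMap_sub_fst_isBigO (hx : RegularAt L x₀) (n : ℕ) :
    (fun p : (E × E) × ℝ => taylorMap L n p.2 p.1 - p.1) =O[𝓝 (x₀, 0)] fun p => p.2 := by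
  simpa only [taylorMap_zero] using isBigO_sub_apply_zero (hx.taylorMap n 0)

/-- Up to `O(h^n)`, the reversed Taylor step has the same difference quotient. -/
lemma lieMean_snd_reverse (hx : RegularAt L x₀) (n : ℕ) :
    (fun p : (E × E) × ℝ => lieMean (elField L) Prod.snd n (-p.2) (taylorMap L n p.2 p.1) -
      lieMean (elField L) Prod.snd n p.2 p.1) =O[𝓝 (x₀, 0)] fun p => p.2 ^ n := by
  obtain ⟨ϕ, hϕ⟩ := exists_isLocalFlow hx.elField
  have hW := contDiffAt_lieMean hx.elField (contDiffAt_snd (𝕜 := ℝ) (n := ∞)) n 0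
  have hsm : ContDiffAt ℝ ∞ (fun p : (E × E) × ℝ =>
      lieMean (elField L) (Prod.snd : E × E → E) n (-p.2) (taylorMap L n p.2 p.1)) (x₀, 0) :=
    ContDiffAt.comp (g := fun p : (E × E) × ℝ => lieMean (elField L) Prod.snd n p.2 p.1)
      (f := fun p : (E × E) × ℝ => (taylorMap L n p.2 p.1, -p.2)) (x₀, (0 : ℝ))
      (by simpa [taylorMap_zero] using hW) (contDiffAt_reverse hx n)
  refine isBigO_of_smul_isBigO (hsm.sub hW) ?_
  have h1 : (fun p : (E × E) × ℝ => p.1 - taylorMap L n (-p.2) (ϕ p))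
      =O[𝓝 (x₀, 0)] fun p => p.2 ^ (n + 1) := by
    refine (hx.flow_sub_taylorMap hϕ n 0 1).congr' ?_ EventuallyEq.rfl
    filter_upwards [(continuous_fst.tendsto (x₀, (0 : ℝ))).eventually hϕ.initial] with p hp
    simp [hp]
  have h2 : (fun p : (E × E) × ℝ => taylorMap L n (-p.2) (ϕ p) -
      taylorMap L n (-p.2) (taylorMap L n p.2 p.1)) =O[𝓝 (x₀, 0)] fun p => p.2 ^ (n + 1) := by
    refine (isBigO_comp_sub_comp (hx.taylorMap n 0) (tendsto_prodMk_neg hϕ.tendsto)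
      (tendsto_reverse hx n)).trans ?_
    refine IsBigO.trans (IsBigO.of_bound 1 (Eventually.of_forall fun p => ?_))
      (hx.flow_sub_taylorMap_one hϕ n)
    simp [Prod.norm_def]
  refine (h1.add h2).prod_left_fst.congr_left fun p => ?_
  have e1 := taylorMap_fst_eq L n p.2 p.1
  have e2 := taylorMap_fst_eq L n (-p.2) (taylorMap L n p.2 p.1)
  rw [← Prod.fst_add, sub_add_sub_cancel, Prod.fst_sub, e2, e1, smul_sub, neg_smul]
  abel

variable {r : ℕ} {V : (E × E) × ℝ → E}

/-- For end points taken from the Taylor method of order `r + 2`, the initial velocity obtained from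
the inverse problem of order `r + 1` is accurate to `O(h^(r+1))`. -/
lemma IsInverseVel.leftEnd_accuracy (hx : RegularAt L x₀) (hV : IsInverseVel L (r + 1) x₀ V) :
    (fun p => ((displacementMap L (r + 2) p).1.1, V (displacementMap L (r + 2) p)) - p.1)
      =O[𝓝 (x₀, 0)] fun p => p.2 ^ (r + 1) := by
  have h1 := (isBigO_comp_sub_comp hV.contDiffAt (tendsto_displacementMap hx (r + 1))
    (tendsto_displacementMap hx r)).trans
    ((((isBigO_zero _ _).prod_left (lieMean_succ_sub_isBigO hx.elField
      (contDiffAt_snd (𝕜 := ℝ) (n := ∞)) (r + 1))).prod_left (isBigO_zero _ _)).congr_left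
      fun p => show ((((0 : E), _), (0 : ℝ)) : (E × E) × ℝ) = _ by simp [displacementMap])
  refine ((isBigO_zero (fun p : (E × E) × ℝ => p.2 ^ (r + 1)) (𝓝 (x₀, 0))).prod_left
    (h1.congr' ?_ EventuallyEq.rfl) : (fun p : (E × E) × ℝ => ((0 : E),
      V (displacementMap L (r + 2) p) - p.1.2)) =O[_] _).congr_left fun p => ?_
  · filter_upwards [hV.left_inv] with p hp
    rw [← hp]; rfl
  · ext <;> simp [displacementMap]

/-- For end points taken from the Taylor method of order `r + 2`, the velocity at the right end
point obtained from the inverse problem of order `r + 1` is accurate to `O(h^(r+1))`. -/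
lemma IsInverseVel.rightEnd_accuracy (hx : RegularAt L x₀) (hV : IsInverseVel L (r + 1) x₀ V)
    {ϕ : (E × E) × ℝ → E × E} (hϕ : IsLocalFlow (elField L) x₀ ϕ) :
    (fun p => ((swapEnds (displacementMap L (r + 2) p)).1.1,
      V (swapEnds (displacementMap L (r + 2) p))) - ϕ p)
      =O[𝓝 (x₀, 0)] fun p => p.2 ^ (r + 1) := by
  set Γ : (E × E) × ℝ → E × E := fun p => taylorMap L (r + 2) p.2 p.1 with hΓ
  have hrev : Tendsto (fun p : (E × E) × ℝ => (Γ p, -p.2)) (𝓝 (x₀, 0)) (𝓝 (x₀, 0)) :=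
    tendsto_reverse hx (r + 2)
  have hW : (fun p : (E × E) × ℝ => lieMean (elField L) Prod.snd (r + 2) p.2 p.1 -
      lieMean (elField L) Prod.snd (r + 1) (-p.2) (Γ p)) =O[𝓝 (x₀, 0)] fun p => p.2 ^ (r + 1) := by
    have h1 := (lieMean_succ_sub_isBigO hx.elField
      (contDiffAt_snd (𝕜 := ℝ) (n := ∞)) (r + 1)).comp_tendsto hrev
    have h2 : (fun p : (E × E) × ℝ => (-p.2) ^ (r + 1)) =O[𝓝 (x₀, 0)] fun p => p.2 ^ (r + 1) :=
      IsBigO.of_bound 1 (Eventually.of_forall fun p => by simp)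
    have h3 := (lieMean_snd_reverse hx (r + 2)).trans (isBigO_pow_of_le (r + 1).le_succ)
    refine ((h1.trans h2).sub h3).congr_left fun p => ?_
    simp [Γ]
  have h1 := (isBigO_comp_sub_comp hV.contDiffAt
    ((tendsto_swapEnds x₀).comp (tendsto_displacementMap hx (r + 1)))
    ((tendsto_displacementMap hx r).comp hrev)).trans
    ((((isBigO_zero _ _).prod_left hW).prod_left (isBigO_zero _ _)).congr_left
      fun p => show ((((0 : E), _), (0 : ℝ)) : (E × E) × ℝ) = _ by
        simp only [Function.comp_apply, swapEnds_displacementMap]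
        simp [displacementMap, Γ])
  have h2 : (fun p : (E × E) × ℝ => V (swapEnds (displacementMap L (r + 2) p)) - (Γ p).2)
      =O[𝓝 (x₀, 0)] fun p => p.2 ^ (r + 1) := by
    refine h1.congr' ?_ EventuallyEq.rfl
    filter_upwards [hrev.eventually hV.left_inv] with p hp
    rw [← hp]; rfl
  have h3 := (hx.flow_sub_taylorMap_one hϕ (r + 2)).trans
    (isBigO_pow_of_le (by omega : r + 1 ≤ r + 2 + 1))
  refine (((isBigO_zero _ _).prod_left h2).sub h3).congr_left fun p => ?_
  rw [swapEnds_displacementMap]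
  ext <;> simp [Γ]

/-- The node values are accurate to `O(h^(r+1))` along the exact solution. The positions are
expanded one term further than the velocities, but both inherit this bound from the velocities at
the end points. -/
lemma scaledNode_accuracy (hx : RegularAt L x₀) (hV : IsInverseVel L (r + 1) x₀ V)
    {ϕ : (E × E) × ℝ → E × E} (hϕ : IsLocalFlow (elField L) x₀ ϕ) (c : ℝ) :
    (fun p => scaledNode L (r + 1) V c (displacementMap L (r + 2) p) - ϕ (p.1, c * p.2))
      =O[𝓝 (x₀, 0)] fun p => p.2 ^ (r + 1) := by
  set Y₀ : (E × E) × ℝ → E × E := fun p =>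
    ((displacementMap L (r + 2) p).1.1, V (displacementMap L (r + 2) p))
  set Y₁ : (E × E) × ℝ → E × E := fun p =>
    ((swapEnds (displacementMap L (r + 2) p)).1.1, V (swapEnds (displacementMap L (r + 2) p)))
  have hY₀ : (fun p => Y₀ p - p.1) =O[𝓝 (x₀, 0)] fun p => p.2 ^ (r + 1) := hV.leftEnd_accuracy hx
  have hY₁ : (fun p => Y₁ p - ϕ p) =O[𝓝 (x₀, 0)] fun p => p.2 ^ (r + 1) :=
    hV.rightEnd_accuracy hx hϕ
  have hY₀t : Tendsto Y₀ (𝓝 (x₀, 0)) (𝓝 x₀) :=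
    hV.tendsto_leftEnd.comp (tendsto_displacementMap hx (r + 1))
  have hY₁t : Tendsto Y₁ (𝓝 (x₀, 0)) (𝓝 x₀) :=
    hV.tendsto_leftEnd.comp ((tendsto_swapEnds x₀).comp (tendsto_displacementMap hx (r + 1)))
  by_cases hc0 : c = 0
  · refine hY₀.congr' ?_ EventuallyEq.rfl
    filter_upwards [(continuous_fst.tendsto (x₀, (0 : ℝ))).eventually hϕ.initial] with p hp
    simp [scaledNode, hc0, hp, Y₀]
  by_cases hc1 : c = 1
  · refine hY₁.congr_left fun p => ?_
    simp [scaledNode, hc1, Y₁]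
  have hmul : ∀ (d : ℝ) {Y : (E × E) × ℝ → E × E}, Tendsto Y (𝓝 (x₀, 0)) (𝓝 x₀) →
      Tendsto (fun p => (Y p, d * p.2)) (𝓝 (x₀, (0 : ℝ))) (𝓝 (x₀, 0)) := by
    intro d Y hY
    refine hY.prodMk_nhds ?_
    have : Continuous fun p : (E × E) × ℝ => d * p.2 := by fun_prop
    simpa using this.tendsto (x₀, (0 : ℝ))
  have hlip : ∀ {G : Type _} [NormedAddCommGroup G] [NormedSpace ℝ G] (φ : E × E → G),
      ContDiffAt ℝ ∞ φ x₀ → ∀ (n : ℕ) (d : ℝ) {Y Y' : (E × E) × ℝ → E × E},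
      Tendsto Y (𝓝 (x₀, 0)) (𝓝 x₀) → Tendsto Y' (𝓝 (x₀, 0)) (𝓝 x₀) →
      ((fun p => Y p - Y' p) =O[𝓝 (x₀, 0)] fun p => p.2 ^ (r + 1)) →
      (fun p => lieTaylor (elField L) φ n (d * p.2) (Y p) -
        lieTaylor (elField L) φ n (d * p.2) (Y' p)) =O[𝓝 (x₀, 0)] fun p => p.2 ^ (r + 1) := by
    intro G _ _ φ hφ n d Y Y' hY hY' h
    refine (isBigO_comp_sub_comp (contDiffAt_lieTaylor hx.elField hφ n 0) (hmul d hY)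
      (hmul d hY')).trans (IsBigO.trans (IsBigO.of_bound 1 (Eventually.of_forall fun p => ?_)) h)
    simp [Prod.norm_def]
  -- The expansions started at both ends approximate the exact solution.
  have hleft : ∀ {G : Type _} [NormedAddCommGroup G] [NormedSpace ℝ G] (φ : E × E → G),
      ContDiffAt ℝ ∞ φ x₀ → ∀ n, r + 1 ≤ n →
      (fun p => lieTaylor (elField L) φ n (c * p.2) (Y₀ p) - φ (ϕ (p.1, c * p.2)))
        =O[𝓝 (x₀, 0)] fun p => p.2 ^ (r + 1) := by
    intro G _ _ φ hφ n hn
    have h1 := hlip φ hφ n c hY₀t (continuous_fst.tendsto (x₀, (0 : ℝ))) hY₀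
    have h2 := (hϕ.taylor_zero hx.elField hφ n c).trans (isBigO_pow_of_le hn)
    refine (h1.sub h2).congr_left fun p => ?_
    abel
  have hright : ∀ {G : Type _} [NormedAddCommGroup G] [NormedSpace ℝ G] (φ : E × E → G),
      ContDiffAt ℝ ∞ φ x₀ → ∀ n, r + 1 ≤ n →
      (fun p => lieTaylor (elField L) φ n ((c - 1) * p.2) (Y₁ p) - φ (ϕ (p.1, c * p.2)))
        =O[𝓝 (x₀, 0)] fun p => p.2 ^ (r + 1) := by
    intro G _ _ φ hφ n hn
    have h1 := hlip φ hφ n (c - 1) hY₁t hϕ.tendsto hY₁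
    have h2 := (hϕ.taylor hx.elField hφ n c 1).trans (isBigO_pow_of_le hn)
    simp only [one_mul] at h2
    refine (h1.sub h2).congr_left fun p => ?_
    abel
  have hcomb : ∀ {G : Type _} [NormedAddCommGroup G] [NormedSpace ℝ G] (φ : E × E → G),
      ContDiffAt ℝ ∞ φ x₀ → ∀ n, r + 1 ≤ n →
      (fun p => (c • lieTaylor (elField L) φ n (c * p.2) (Y₀ p) +
        (1 - c) • lieTaylor (elField L) φ n ((1 - c) * -p.2) (Y₁ p)) - φ (ϕ (p.1, c * p.2)))
        =O[𝓝 (x₀, 0)] fun p => p.2 ^ (r + 1) := by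
    intro G _ _ φ hφ n hn
    refine (((hleft φ hφ n hn).const_smul_left c).add
      ((hright φ hφ n hn).const_smul_left (1 - c))).congr_left fun p => ?_
    change c • (lieTaylor (elField L) φ n (c * p.2) (Y₀ p) - φ (ϕ (p.1, c * p.2))) + (1 - c) •
      (lieTaylor (elField L) φ n ((c - 1) * p.2) (Y₁ p) - φ (ϕ (p.1, c * p.2))) = _
    rw [show (1 - c) * -p.2 = (c - 1) * p.2 by ring]
    module
  refine ((hcomb Prod.fst contDiffAt_fst (r + 1 + 1) (by omega)).prod_left
    (hcomb Prod.snd contDiffAt_snd (r + 1) le_rfl)).congr_left fun p => ?_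
  simp only [scaledNode, if_neg hc0, if_neg hc1, taylorMap_eq, Nat.add_sub_cancel]
  rfl

variable {m : ℕ} {b c : Fin m → ℝ}

/-- The quadrature rule of order `n`, applied along the exact solution, gives the Taylor mean of the
Lagrangian. -/
lemma sum_flow_sub_lieMean (hx : RegularAt L x₀) {ϕ : (E × E) × ℝ → E × E}
    (hϕ : IsLocalFlow (elField L) x₀ ϕ) {n : ℕ} (hord : QuadratureOrder b c n) :
    (fun p : (E × E) × ℝ => ∑ i, b i * L (ϕ (p.1, c i * p.2)) - lieMean (elField L) L n p.2 p.1)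
      =O[𝓝 (x₀, 0)] fun p => p.2 ^ n := by
  have h := IsBigO.sum (s := Finset.univ) fun i _ =>
    (hϕ.taylor_zero hx.elField hx.contDiffAt n (c i)).const_mul_left (b i)
  refine h.congr_left fun p => ?_
  rw [← hord.sum_lieTaylor, ← Finset.sum_sub_distrib]
  simp only [Finset.sum_apply, mul_sub]

/-- Up to `O(h^n)`, the Taylor mean of the Lagrangian is the same for the reversed Taylor step: both
are the quadrature of `L` along the same arc of the exact solution. -/
lemma lieMean_reverse (hx : RegularAt L x₀) {n : ℕ} (hord : QuadratureOrder b c n)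
    (hsymm : QuadratureSymmetric b c) :
    (fun p : (E × E) × ℝ => lieMean (elField L) L n (-p.2) (taylorMap L n p.2 p.1) -
      lieMean (elField L) L n p.2 p.1) =O[𝓝 (x₀, 0)] fun p => p.2 ^ n := by
  obtain ⟨ϕ, hϕ⟩ := exists_isLocalFlow hx.elField
  have h1 := IsBigO.sum (s := Finset.univ) fun i _ =>
    (hϕ.taylor hx.elField hx.contDiffAt n (c i) 1).const_mul_left (b i)
  have h2 := sum_flow_sub_lieMean hx hϕ hord
  have h3 : (fun p : (E × E) × ℝ => lieMean (elField L) L n (-p.2) (ϕ p) -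
      lieMean (elField L) L n (-p.2) (taylorMap L n p.2 p.1)) =O[𝓝 (x₀, 0)] fun p => p.2 ^ n := by
    refine (isBigO_comp_sub_comp (contDiffAt_lieMean hx.elField hx.contDiffAt n 0)
      (tendsto_prodMk_neg hϕ.tendsto) (tendsto_reverse hx n)).trans (IsBigO.trans (IsBigO.of_bound 1
        (Eventually.of_forall fun p => ?_)) ((hx.flow_sub_taylorMap_one hϕ n).trans
        (isBigO_pow_of_le n.le_succ)))
    simp [Prod.norm_def]
  refine ((h2.sub h1).sub h3).congr_left fun p => ?_
  simp only [Finset.sum_apply, mul_sub, Finset.sum_sub_distrib, one_mul]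
  rw [hord.sum_lieTaylor_reverse hsymm]
  ring

/-- The scaled discrete Lagrangian agrees with the Taylor mean of the Lagrangian to `O(h^(r+2))`.
The bound `O(h^(r+1))` does not need the symmetry of the rule, which gains one order since `r + 1`
is odd. -/
lemma scaledLagrangian_accuracy (hx : RegularAt L x₀) (hV : IsInverseVel L (r + 1) x₀ V)
    (hr : Odd (r + 1)) (hord : QuadratureOrder b c (r + 2)) (hsymm : QuadratureSymmetric b c) :
    (fun p => scaledLagrangian L (r + 1) b c V (displacementMap L (r + 2) p) -
      lieMean (elField L) L (r + 2) p.2 p.1) =O[𝓝 (x₀, 0)] fun p => p.2 ^ (r + 2) := by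
  have hl := contDiffAt_scaledLagrangian hx hV b c
  have hlD : ContDiffAt ℝ ∞ (fun p => scaledLagrangian L (r + 1) b c V
      (displacementMap L (r + 2) p)) (x₀, 0) :=
    ContDiffAt.comp (g := scaledLagrangian L (r + 1) b c V) (f := displacementMap L (r + 2))
      (x₀, (0 : ℝ)) (by rw [displacementMap_zero]; exact hl)
      (contDiffAt_displacementMap hx (r + 2))
  refine isBigO_succ_of_symmetric (r := r + 1)
    (Γ := fun p => taylorMap L (r + 2) p.2 p.1)
    (hlD.sub (contDiffAt_lieMean hx.elField hx.contDiffAt (r + 2) 0)) hr ?_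
    (hx.tendsto_taylorMap _) (taylorMap_sub_fst_isBigO hx _) ?_
  · obtain ⟨ϕ, hϕ⟩ := exists_isLocalFlow hx.elField
    have h1 : (fun p => ∑ i, b i * (L (scaledNode L (r + 1) V (c i) (displacementMap L (r + 2) p)) -
        L (ϕ (p.1, c i * p.2)))) =O[𝓝 (x₀, 0)] fun p => p.2 ^ (r + 1) := by
      refine IsBigO.fun_sum fun i _ => IsBigO.const_mul_left ?_ _
      refine (isBigO_comp_sub_comp hx.contDiffAt ?_ (hϕ.tendsto_const_mul (c i))).trans
        (scaledNode_accuracy hx hV hϕ (c i))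
      have := (contDiffAt_scaledNode hx hV (c i)).continuousAt.tendsto
      rw [scaledNode_zero hV] at this
      exact this.comp (tendsto_displacementMap hx (r + 1))
    have h2 := (sum_flow_sub_lieMean hx hϕ hord).trans
      (isBigO_pow_of_le (r + 1).le_succ)
    refine (h1.add h2).congr_left fun p => ?_
    simp only [mul_sub, Finset.sum_sub_distrib, scaledLagrangian]
    ring
  · have h1 := lieMean_reverse hx hord hsymm
    have h2 := (isBigO_comp_sub_comp hl
      ((tendsto_displacementMap hx (r + 1)).comp (tendsto_reverse hx (r + 2)))
      ((tendsto_swapEnds x₀).comp (tendsto_displacementMap hx (r + 1)))).trans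
      ((((isBigO_zero _ _).prod_left (lieMean_snd_reverse hx (r + 2))).prod_left
        (isBigO_zero _ _)).congr_left
        fun p => show ((((0 : E), _), (0 : ℝ)) : (E × E) × ℝ) = _ by
          simp only [Function.comp_apply, swapEnds_displacementMap]
          simp [displacementMap])
    refine (h2.sub h1).congr_left fun p => ?_
    simp only [Function.comp_apply, scaledLagrangian_swapEnds L (r + 1) hsymm]
    ring

end Accuracy

/-! ### One step of the integrator -/

section Step

variable {E : Type*} [NormedAddCommGroup E] [NormedSpace ℝ E]

/-- The derivative of `f ((q, w), h)` with respect to `q`. -/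
def derivQ (f : (E × E) × ℝ → ℝ) (p : (E × E) × ℝ) : E →L[ℝ] ℝ :=
  (derivX f p).comp (ContinuousLinearMap.inl ℝ E E)

/-- The derivative of `f ((q, w), h)` with respect to `w`. -/
def derivW (f : (E × E) × ℝ → ℝ) (p : (E × E) × ℝ) : E →L[ℝ] ℝ :=
  (derivX f p).comp (ContinuousLinearMap.inr ℝ E E)

/-- The momentum `-D₁ L_d` at the left end point in terms of
`f ((q, w), h) = L_d (q, q + h w; h) / h`; the momentum `D₂ L_d` at the right end point is
`derivW f`. -/
def leftMomentum (f : (E × E) × ℝ → ℝ) (p : (E × E) × ℝ) : E →L[ℝ] ℝ :=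
  derivW f p - p.2 • derivQ f p

variable {x₀ : E × E} {f : (E × E) × ℝ → ℝ}

lemma contDiffAt_derivQ (hf : ContDiffAt ℝ ∞ f (x₀, 0)) : ContDiffAt ℝ ∞ (derivQ f) (x₀, 0) :=
  (contDiffAt_derivX hf).clm_comp contDiffAt_const

lemma contDiffAt_derivW (hf : ContDiffAt ℝ ∞ f (x₀, 0)) : ContDiffAt ℝ ∞ (derivW f) (x₀, 0) :=
  (contDiffAt_derivX hf).clm_comp contDiffAt_const

lemma contDiffAt_leftMomentum (hf : ContDiffAt ℝ ∞ f (x₀, 0)) :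
    ContDiffAt ℝ ∞ (leftMomentum f) (x₀, 0) :=
  (contDiffAt_derivW hf).sub (contDiffAt_snd.smul (contDiffAt_derivQ hf))

/-- The derivatives of `(q₀, q₁) ↦ h ℓ ((q₀, (q₁ - q₀) / h), h)`. -/
lemma hasDerivs_of_eventually_eq {Ld : E → E → ℝ} {p : (E × E) × ℝ} (hp0 : p.2 ≠ 0)
    (hf : DifferentiableAt ℝ f p)
    (hLd : ∀ᶠ p' in 𝓝 p, p'.2 = p.2 → Ld p'.1.1 (p'.1.1 + p.2 • p'.1.2) = p.2 * f p') :
    DifferentiableAt ℝ (fun z : E × E => Ld z.1 z.2) (p.1.1, p.1.1 + p.2 • p.1.2) ∧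
    -fderiv ℝ (fun q => Ld q (p.1.1 + p.2 • p.1.2)) p.1.1 = leftMomentum f p ∧
    fderiv ℝ (fun q => Ld p.1.1 q) (p.1.1 + p.2 • p.1.2) = derivW f p := by
  set z₀ : E × E := (p.1.1, p.1.1 + p.2 • p.1.2) with hz₀
  set σ : E × E → (E × E) × ℝ := fun z => ((z.1, p.2⁻¹ • (z.2 - z.1)), p.2) with hσ
  have hσ0 : σ z₀ = p := by
    simp [hσ, hz₀, smul_smul, inv_mul_cancel₀ hp0]
  have hσd : HasFDerivAt σ (((ContinuousLinearMap.fst ℝ E E).prod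
      (p.2⁻¹ • (ContinuousLinearMap.snd ℝ E E - ContinuousLinearMap.fst ℝ E E))).prod 0) z₀ :=
    (hasFDerivAt_fst.prodMk ((hasFDerivAt_snd.sub hasFDerivAt_fst).const_smul p.2⁻¹)).prodMk
      (hasFDerivAt_const p.2 z₀)
  have hLdσ : (fun z : E × E => Ld z.1 z.2) =ᶠ[𝓝 z₀] fun z => p.2 * f (σ z) := by
    have h1 : Tendsto σ (𝓝 z₀) (𝓝 p) := by
      have := hσd.continuousAt.tendsto
      rwa [hσ0] at this
    filter_upwards [h1.eventually hLd] with z hz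
    have := hz rfl
    simpa [hσ, smul_smul, mul_inv_cancel₀ hp0] using this
  have hd := ((HasFDerivAt.comp (g := f) z₀ (by rw [hσ0]; exact hf.hasFDerivAt) hσd).const_mul
    p.2).congr_of_eventuallyEq hLdσ
  have hdiff : DifferentiableAt ℝ (fun z : E × E => Ld z.1 z.2) z₀ := hd.differentiableAt
  have hsplit : ∀ (ξ η : E), fderiv ℝ f p ((ξ, p.2⁻¹ • η), 0) =
      fderiv ℝ f p ((ξ, 0), 0) + p.2⁻¹ * fderiv ℝ f p ((0, η), 0) := by
    intro ξ η
    rw [← smul_eq_mul, ← map_smul, ← map_add]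
    simp
  refine ⟨hdiff, ?_, ?_⟩
  · have h1 := fderiv_partial_left hdiff
    change fderiv ℝ (fun q => Ld q (p.1.1 + p.2 • p.1.2)) p.1.1 = _ at h1
    rw [h1, hd.fderiv]
    refine ContinuousLinearMap.ext fun ξ => ?_
    have h2 := hsplit ξ (-ξ)
    have h3 : fderiv ℝ f p ((0, -ξ), 0) = -fderiv ℝ f p ((0, ξ), 0) := by
      rw [← map_neg]; simp
    simp [leftMomentum, derivW, derivQ, derivX]
    simp only [smul_neg, h3] at h2
    rw [h2]
    field_simp
    ring
  · have h1 := fderiv_partial_right hdiff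
    change fderiv ℝ (fun q => Ld p.1.1 q) (p.1.1 + p.2 • p.1.2) = _ at h1
    rw [h1, hd.fderiv]
    refine ContinuousLinearMap.ext fun ξ => ?_
    have h2 := hsplit 0 ξ
    have h3 : fderiv ℝ f p ((0, 0), 0) = 0 := map_zero (fderiv ℝ f p)
    simp [derivW, derivX]
    rw [h2, h3]
    field_simp
    ring

variable {L : E × E → ℝ} {r : ℕ} {V : (E × E) × ℝ → E} {m : ℕ} {b c : Fin m → ℝ}

/-- For `h ≠ 0`, the steps of the integrator are described by the smooth function
`scaledLagrangian`. -/
lemma eventually_isStep_iff [CompleteSpace E] (hx : RegularAt L x₀)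
    (hV : IsInverseVel L (r + 1) x₀ V) :
    ∀ᶠ p in 𝓝 (x₀, (0 : ℝ)), p.2 ≠ 0 → ∀ y₀ y₁ : E →L[ℝ] ℝ,
      IsStep (discreteLagrangian L (r + 1) b c) p.2 (p.1.1, y₀) (p.1.1 + p.2 • p.1.2, y₁) ↔
        y₀ = leftMomentum (scaledLagrangian L (r + 1) b c V) p ∧
        y₁ = derivW (scaledLagrangian L (r + 1) b c V) p := by
  filter_upwards [(eventually_discreteLagrangian_eq hV b c).eventually_nhds,
    eventually_differentiableAt (contDiffAt_scaledLagrangian hx hV b c)] with p hp hd hp0 y₀ y₁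
  obtain ⟨h1, h2, h3⟩ := hasDerivs_of_eventually_eq
    (Ld := discreteLagrangian L (r + 1) b c p.2) hp0 hd
    (hp.mono fun p' hp' h => by rw [← h]; exact hp' (h ▸ hp0))
  simp only [IsStep, h1, h2, h3, true_and]

/-- At `h = 0` the momentum of the discrete Lagrangian is the momentum of `L`. -/
lemma eventually_derivW_zero [CompleteSpace E] (hx : RegularAt L x₀)
    (hV : IsInverseVel L (r + 1) x₀ V) (hb : ∑ i, b i = 1) :
    ∀ᶠ x in 𝓝 x₀, derivW (scaledLagrangian L (r + 1) b c V) (x, 0) = momentum L x := by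
  filter_upwards [(eventually_scaledLagrangian_zero hV hb c).eventually_nhds,
    (Continuous.prodMk_left (0 : ℝ)).tendsto x₀ |>.eventually
      (eventually_differentiableAt (contDiffAt_scaledLagrangian hx hV b c)),
    eventually_differentiableAt hx.contDiffAt] with x h1 h2 h3
  rw [derivW, derivX_eq h2, momentum, fderiv_partial_right h3]
  congr 1
  exact EventuallyEq.fderiv_eq h1

lemma isBigO_of_comp_isBigO {P : Type*} {l : Filter P} {B : P → E →L[ℝ] ℝ} {Z : P → E →L[ℝ] E}
    {u : P → ℝ} (hZ : Tendsto Z l (𝓝 (ContinuousLinearMap.id ℝ E)))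
    (h : (fun p => (B p).comp (Z p)) =O[l] u) : B =O[l] u := by
  refine IsBigO.trans (IsBigO.of_bound 2 ?_) h
  filter_upwards [hZ.eventually (Metric.closedBall_mem_nhds _ (by norm_num : (0 : ℝ) < 1 / 2))]
    with p hp
  rw [dist_eq_norm] at hp
  have h1 : B p = (B p).comp (Z p) - (B p).comp (Z p - ContinuousLinearMap.id ℝ E) := by
    rw [ContinuousLinearMap.comp_sub]; simp
  have h2 : ‖(B p).comp (Z p - ContinuousLinearMap.id ℝ E)‖ ≤ ‖B p‖ * (1 / 2) :=
    (ContinuousLinearMap.opNorm_comp_le _ _).trans (by gcongr)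
  have h3 : ‖B p‖ ≤ ‖(B p).comp (Z p)‖ + ‖(B p).comp (Z p - ContinuousLinearMap.id ℝ E)‖ := by
    conv_lhs => rw [h1]
    exact norm_sub_le _ _
  linarith

/-- The momenta of the discrete Lagrangian at a step of the Taylor approximation: comparing the
derivative of the discrete action with the first variation formula gives the momentum at the right
end point and the change of momentum over the step. -/
lemma momenta_accuracy [CompleteSpace E] (hx : RegularAt L x₀) (hV : IsInverseVel L (r + 1) x₀ V)
    (hr : Odd (r + 1)) (hord : QuadratureOrder b c (r + 2)) (hsymm : QuadratureSymmetric b c) :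
    ((fun p => p.2 • (derivW (scaledLagrangian L (r + 1) b c V) (displacementMap L (r + 2) p) -
      momentum L (taylorMap L (r + 2) p.2 p.1))) =O[𝓝 (x₀, 0)] fun p => p.2 ^ (r + 3)) ∧
    (fun p => p.2 • derivQ (scaledLagrangian L (r + 1) b c V) (displacementMap L (r + 2) p) -
      (momentum L (taylorMap L (r + 2) p.2 p.1) - momentum L p.1)) =O[𝓝 (x₀, 0)]
        fun p => p.2 ^ (r + 3) := by
  set ℓ := scaledLagrangian L (r + 1) b c V
  set D := displacementMap L (r + 2)
  set Γ : (E × E) × ℝ → E × E := fun p => taylorMap L (r + 2) p.2 p.1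
  set W : (E × E) × ℝ → E := fun p => lieMean (elField L) Prod.snd (r + 2) p.2 p.1
  set A : (E × E) × ℝ → ℝ := fun p => lieMean (elField L) L (r + 2) p.2 p.1
  set p₀ : (E × E) × ℝ := (x₀, 0)
  have hl : ContDiffAt ℝ ∞ ℓ p₀ := contDiffAt_scaledLagrangian hx hV b c
  have hD : ContDiffAt ℝ ∞ D p₀ := contDiffAt_displacementMap hx (r + 2)
  have hDt : Tendsto D (𝓝 p₀) (𝓝 p₀) := tendsto_displacementMap hx (r + 1)
  have hW : ContDiffAt ℝ ∞ W p₀ := contDiffAt_lieMean hx.elField contDiffAt_snd (r + 2) 0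
  have hA : ContDiffAt ℝ ∞ A p₀ := contDiffAt_lieMean hx.elField hx.contDiffAt (r + 2) 0
  have hlD : ContDiffAt ℝ ∞ (fun p => ℓ (D p)) p₀ :=
    ContDiffAt.comp (g := ℓ) (f := D) p₀ (by
      rw [show D p₀ = p₀ from displacementMap_zero L (r + 1) x₀]; exact hl) hD
  -- the derivative of the error of the discrete action
  have h1 : (fun p => derivX (fun p => ℓ (D p)) p - derivX A p) =O[𝓝 p₀] fun p => p.2 ^ (r + 2) :=
    isBigO_derivX_sub hlD hA (scaledLagrangian_accuracy hx hV hr hord hsymm)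
  have h2 : (fun p : (E × E) × ℝ => p.2 • (derivX (fun p => ℓ (D p)) p - derivX A p))
      =O[𝓝 p₀] fun p => p.2 ^ (r + 3) := by
    simpa [pow_succ' _ (r + 2)] using (isBigO_refl (fun p : (E × E) × ℝ => p.2) (𝓝 p₀)).smul h1
  have h3 := hx.derivX_action (r + 2)
  -- the sum of both, in terms of the errors of the momenta
  have h4 : (fun p => (p.2 • derivQ ℓ (D p) - (momentum L (Γ p) - momentum L p.1)).comp
        (ContinuousLinearMap.fst ℝ E E) +
      (p.2 • (derivW ℓ (D p) - momentum L (Γ p))).comp (derivX W p)) =O[𝓝 p₀]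
        fun p => p.2 ^ (r + 3) := by
    refine (h2.add h3).congr' ?_ EventuallyEq.rfl
    filter_upwards [eventually_differentiableAt hA, eventually_differentiableAt hW,
      eventually_differentiableAt hD, hDt.eventually (eventually_differentiableAt hl)]
      with p g1 g2 g3 g4
    have e1 : derivX (fun p : (E × E) × ℝ => p.2 • lieMean (elField L) L (r + 2) p.2 p.1) p =
        p.2 • derivX A p := by
      rw [derivX_eq (f := fun p : (E × E) × ℝ => p.2 • A p) (differentiableAt_snd.smul g1),
        derivX_eq g1]
      have : DifferentiableAt ℝ (fun x => A (x, p.2)) p.1 :=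
        DifferentiableAt.comp (g := A) (f := fun x => (x, p.2)) p.1 g1 (by fun_prop)
      exact fderiv_const_smul this p.2
    have e2 : derivX (fun p : (E × E) × ℝ => (taylorMap L (r + 2) p.2 p.1).1) p =
        ContinuousLinearMap.fst ℝ E E + p.2 • derivX W p := by
      simp only [taylorMap_fst_eq]
      have d1 : DifferentiableAt ℝ (fun p : (E × E) × ℝ => p.1.1 + p.2 • W p) p :=
        (by fun_prop : DifferentiableAt ℝ (fun p : (E × E) × ℝ => p.1.1) p).add
          (differentiableAt_snd.smul g2)
      have d2 : DifferentiableAt ℝ (fun x => W (x, p.2)) p.1 :=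
        DifferentiableAt.comp (g := W) (f := fun x => (x, p.2)) p.1 g2 (by fun_prop)
      have e3 := derivX_eq d1
      have e4 := ((hasFDerivAt_fst (𝕜 := ℝ) (p := p.1)).add
        (d2.hasFDerivAt.const_smul p.2)).fderiv
      rw [derivX_eq g2]
      exact e3.trans e4
    have e5 : derivX (fun p => ℓ (D p)) p = (derivQ ℓ (D p)).comp (ContinuousLinearMap.fst ℝ E E) +
        (derivW ℓ (D p)).comp (derivX W p) := by
      have f1 : fderiv ℝ (fun p => ℓ (D p)) p = _ := fderiv_comp (g := ℓ) (f := D) p g4 g3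
      have f2 : HasFDerivAt D _ p :=
        ((hasFDerivAt_fst.comp p hasFDerivAt_fst).prodMk g2.hasFDerivAt).prodMk hasFDerivAt_snd
      refine ContinuousLinearMap.ext fun ξ => ?_
      simp only [derivX, derivQ, derivW, f1, f2.fderiv, ContinuousLinearMap.comp_apply,
        add_apply, ← map_add]
      congr 1
      simp
    rw [e1, e2, e5]
    refine ContinuousLinearMap.ext fun ξ => ?_
    simp
    ring
  have hB : (fun p => p.2 • (derivW ℓ (D p) - momentum L (Γ p))) =O[𝓝 p₀]
      fun p => p.2 ^ (r + 3) := by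
    refine isBigO_of_comp_isBigO
      (Z := fun p => (derivX W p).comp (ContinuousLinearMap.inr ℝ E E)) ?_ ?_
    · have hc := ((contDiffAt_derivX hW).clm_comp
        (contDiffAt_const (c := ContinuousLinearMap.inr ℝ E E))).continuousAt.tendsto
      have e : (derivX W p₀).comp (ContinuousLinearMap.inr ℝ E E) =
          ContinuousLinearMap.id ℝ E := by
        rw [derivX_eq (hW.differentiableAt (by simp))]
        simp only [W, p₀, lieMean_zero_right]
        have : fderiv ℝ (fun x : E × E => x.2) x₀ = ContinuousLinearMap.snd ℝ E E := fderiv_snd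
        rw [this]
        ext; simp
      rwa [e] at hc
    · have hinr : (fun _ => ContinuousLinearMap.inr ℝ E E) =O[𝓝 p₀] fun _ => (1 : ℝ) :=
        isBigO_const_const _ one_ne_zero _
      refine (isBigO_clm_comp_one h4 hinr).congr_left fun p => ?_
      refine ContinuousLinearMap.ext fun ξ => ?_
      simp
  refine ⟨hB, ?_⟩
  have hinl : (fun _ => ContinuousLinearMap.inl ℝ E E) =O[𝓝 p₀] fun _ => (1 : ℝ) :=
    isBigO_const_const _ one_ne_zero _
  have hC := (h4.sub (isBigO_clm_comp_one hB (isBigO_one_of_contDiffAt (contDiffAt_derivX hW))))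
  refine (isBigO_clm_comp_one hC hinl).congr_left fun p => ?_
  refine ContinuousLinearMap.ext fun ξ => ?_
  simp [Γ]

end Step

/-! ### Existence, uniqueness and accuracy of the step -/

section Order

variable {E : Type*} [NormedAddCommGroup E] [NormedSpace ℝ E] [CompleteSpace E]
  {L : E × E → ℝ} {x₀ : E × E}

/-- The step equation `-D₁ L_d (q, q + h w) = ∂L/∂v (q, v)` has a solution `w = sol ((q, v), h)`,
unique in a ball of fixed radius around `v`, and the resulting position and momentum are accurate to
`O(h^(r+3))` for the flow `ϕ`. -/
lemma exists_step {r : ℕ} {V : (E × E) × ℝ → E} {m : ℕ} {b c : Fin m → ℝ} (hx : RegularAt L x₀)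
    (hV : IsInverseVel L (r + 1) x₀ V) (hr : Odd (r + 1)) (hord : QuadratureOrder b c (r + 2))
    (hsymm : QuadratureSymmetric b c) {ϕ : (E × E) × ℝ → E × E}
    (hϕ : IsLocalFlow (elField L) x₀ ϕ) :
    ∃ (sol : (E × E) × ℝ → E) (π : (E × E) × ℝ → E →L[ℝ] ℝ), ∃ ρ > (0 : ℝ),
      (∀ᶠ p in 𝓝 (x₀, (0 : ℝ)), p.2 ≠ 0 →
        IsStep (discreteLagrangian L (r + 1) b c) p.2 (p.1.1, momentum L p.1)
          (p.1.1 + p.2 • sol p, π p) ∧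
        ∀ (w : E) (y : E →L[ℝ] ℝ), ‖w - p.1.2‖ < ρ →
          IsStep (discreteLagrangian L (r + 1) b c) p.2 (p.1.1, momentum L p.1)
            (p.1.1 + p.2 • w, y) → w = sol p ∧ y = π p) ∧
      ((fun p => sol p - p.1.2) =O[𝓝 (x₀, 0)] fun p => p.2) ∧
      ((fun p => p.1.1 + p.2 • sol p - (ϕ p).1) =O[𝓝 (x₀, 0)] fun p => p.2 ^ (r + 3)) ∧
      (fun p => π p - momentum L (ϕ p)) =O[𝓝 (x₀, 0)] fun p => p.2 ^ (r + 3) := by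
  set ℓ := scaledLagrangian L (r + 1) b c V
  set D := displacementMap L (r + 2)
  set Γ : (E × E) × ℝ → E × E := fun p => taylorMap L (r + 2) p.2 p.1
  set W : (E × E) × ℝ → E := fun p => lieMean (elField L) Prod.snd (r + 2) p.2 p.1
  set p₀ : (E × E) × ℝ := (x₀, 0)
  set P := leftMomentum ℓ
  have hl : ContDiffAt ℝ ∞ ℓ p₀ := contDiffAt_scaledLagrangian hx hV b c
  have hPs : ContDiffAt ℝ ∞ P p₀ := contDiffAt_leftMomentum hl
  have hDt : Tendsto D (𝓝 p₀) (𝓝 p₀) := tendsto_displacementMap hx (r + 1)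
  have hb : ∑ i, b i = 1 := by simpa using hord.sum_mul_pow (k := 0) (by omega)
  -- the implicit function theorem for the step equation
  have hP0 : ∀ᶠ x in 𝓝 x₀, P (x, 0) = momentum L x := by
    filter_upwards [eventually_derivW_zero (c := c) hx hV hb] with x hx
    simpa [P, leftMomentum] using hx
  obtain ⟨A, hA⟩ := hx.isInvertible
  have hPd : HasFDerivAt (fun v => P ((x₀.1, v), 0)) (A : E →L[ℝ] E →L[ℝ] ℝ) x₀.2 := by
    rw [hA]
    refine hx.hasFDerivAt_momentum.congr_of_eventuallyEq ?_
    exact (Continuous.prodMk_right x₀.1).tendsto x₀.2 |>.eventually hP0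
  obtain ⟨U, hU, hU0, hUr, hUl⟩ := exists_velocity_inverse (q₀ := x₀.1) (v₀ := x₀.2) hPs
    hP0.self_of_nhds hPd
  have hm : ContDiffAt ℝ ∞ (fun p : (E × E) × ℝ => ((p.1.1, momentum L p.1), p.2)) p₀ :=
    ((contDiffAt_fst.comp _ contDiffAt_fst).prodMk
      (ContDiffAt.comp p₀ hx.momentum contDiffAt_fst)).prodMk contDiffAt_snd
  have hmt : Tendsto (fun p : (E × E) × ℝ => ((p.1.1, momentum L p.1), p.2)) (𝓝 p₀)
      (𝓝 ((x₀.1, momentum L x₀), 0)) := hm.continuousAt.tendsto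
  set sol : (E × E) × ℝ → E := fun p => U ((p.1.1, momentum L p.1), p.2) with hsol
  set S : (E × E) × ℝ → (E × E) × ℝ := fun p => ((p.1.1, sol p), p.2)
  have hSt : Tendsto S (𝓝 p₀) (𝓝 p₀) := by
    have h1 : Tendsto sol (𝓝 p₀) (𝓝 x₀.2) := by
      have := hU.continuousAt.tendsto.comp hmt
      rwa [hU0] at this
    exact (((continuous_fst.comp continuous_fst).tendsto p₀).prodMk_nhds h1).prodMk_nhds
      (continuous_snd.tendsto p₀)
  obtain ⟨hW1, hW2⟩ := momenta_accuracy hx hV hr hord hsymm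
  -- the residual of the Taylor approximation in the step equation
  have hres : (fun p => P (D p) - momentum L p.1) =O[𝓝 p₀] fun p => p.2 ^ (r + 2) := by
    refine isBigO_of_smul_isBigO ?_ ?_
    · refine ContDiffAt.sub ?_ (ContDiffAt.comp p₀ hx.momentum contDiffAt_fst)
      exact ContDiffAt.comp (g := P) (f := D) p₀ (by
        rw [show D p₀ = p₀ from displacementMap_zero L (r + 1) x₀]; exact hPs)
        (contDiffAt_displacementMap hx (r + 2))
    · have h1 : (fun p : (E × E) × ℝ => p.2 • (p.2 • derivQ ℓ (D p) -
          (momentum L (Γ p) - momentum L p.1))) =O[𝓝 p₀] fun p => p.2 ^ (r + 3) := by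
        have h2 : (fun p : (E × E) × ℝ => p.2) =O[𝓝 p₀] fun _ => (1 : ℝ) :=
          isBigO_one_of_contDiffAt contDiffAt_snd
        simpa using h2.smul hW2
      refine (hW1.sub h1).congr_left fun p => ?_
      simp only [P, leftMomentum]
      rw [show (D p).2 = p.2 from rfl]
      module
  -- `sol` and `W` are the values of the smooth inverse `U` at the momenta `∂L/∂v` and `P ∘ D`
  have hsolW : (fun p => sol p - W p) =O[𝓝 p₀] fun p => p.2 ^ (r + 2) := by
    have h0 : Tendsto (fun p => ((p.1.1, P (D p)), p.2)) (𝓝 p₀)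
        (𝓝 ((x₀.1, momentum L x₀), 0)) := by
      have h1 : Tendsto (fun p => P (D p)) (𝓝 p₀) (𝓝 (momentum L x₀)) := by
        have := hPs.continuousAt.tendsto.comp hDt
        rwa [show P p₀ = momentum L x₀ from hP0.self_of_nhds] at this
      exact (((continuous_fst.comp continuous_fst).tendsto p₀).prodMk_nhds h1).prodMk_nhds
        (continuous_snd.tendsto p₀)
    have h2 := (isBigO_comp_sub_comp hU hmt h0).trans
      ((((isBigO_zero _ _).prod_left hres.neg_left).prod_left (isBigO_zero _ _)).congr_left
        fun p => show ((((0 : E), _), (0 : ℝ)) : (E × (E →L[ℝ] ℝ)) × ℝ) = _ by simp)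
    refine h2.congr' ?_ EventuallyEq.rfl
    filter_upwards [hDt.eventually hUl] with p hp
    exact congrArg (fun w => sol p - w) hp
  have hsolv : (fun p => sol p - p.1.2) =O[𝓝 p₀] fun p => p.2 := by
    have h2 : (fun p => W p - p.1.2) =O[𝓝 p₀] fun p => p.2 := by
      simpa only [lieMean_zero_right] using
        isBigO_sub_apply_zero (contDiffAt_lieMean hx.elField contDiffAt_snd (r + 2) 0)
    have h3 : (fun p : (E × E) × ℝ => p.2 ^ (r + 2)) =O[𝓝 p₀] fun p => p.2 := by
      simpa using isBigO_pow_of_le (x₀ := x₀) (by omega : 1 ≤ r + 2)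
    refine ((hsolW.trans h3).add h2).congr_left fun p => ?_
    abel
  have hΓϕ : (fun p => Γ p - ϕ p) =O[𝓝 p₀] fun p => p.2 ^ (r + 3) :=
    (hx.flow_sub_taylorMap_one hϕ (r + 2)).symm
  have hhsol : (fun p => p.2 • (sol p - W p)) =O[𝓝 p₀] fun p => p.2 ^ (r + 3) := by
    simpa [pow_succ' _ (r + 2)] using
      (isBigO_refl (fun p : (E × E) × ℝ => p.2) (𝓝 p₀)).smul hsolW
  refine ⟨sol, fun p => derivW ℓ (S p), ?_⟩
  obtain ⟨ε, hε, hball⟩ := Metric.eventually_nhds_iff.1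
    ((eventually_isStep_iff (b := b) (c := c) hx hV).and hUl)
  refine ⟨ε / 2, half_pos hε, ?_, hsolv, ?_, ?_⟩
  · filter_upwards [hSt.eventually (eventually_isStep_iff (b := b) (c := c) hx hV),
      hmt.eventually hUr, Metric.ball_mem_nhds p₀ (half_pos hε)] with p h1 h2 h3 hp0
    refine ⟨(h1 hp0 _ _).2 ⟨h2.symm, rfl⟩, fun w y hw hstep => ?_⟩
    have hd : dist ((p.1.1, w), p.2) p < ε / 2 := by
      rw [dist_eq_norm]
      simpa [Prod.norm_def, hε] using hw
    obtain ⟨h4, h5⟩ := hball (y := ((p.1.1, w), p.2)) (by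
      calc dist ((p.1.1, w), p.2) p₀ ≤ _ := dist_triangle _ p _
        _ < ε / 2 + ε / 2 := add_lt_add hd h3
        _ = ε := by ring)
    obtain ⟨h6, h7⟩ := (h4 hp0 (momentum L p.1) y).1 hstep
    have h8 : w = sol p := by
      rw [hsol]
      simp only [h6]
      exact h5.symm
    refine ⟨h8, ?_⟩
    rw [h7, h8]
  · refine (hhsol.add hΓϕ.prod_left_fst).congr_left fun p => ?_
    rw [show (Γ p).1 = p.1.1 + p.2 • W p from taylorMap_fst_eq L (r + 2) p.2 p.1,
      smul_sub]
    abel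
  · -- `D₂ L_d = -D₁ L_d + h ∂ℓ/∂q` loses no power of `h`, although `D₂ L_d = ∂ℓ/∂w`.
    have h1 : (fun p : (E × E) × ℝ => p.2 • (derivQ ℓ (S p) - derivQ ℓ (D p))) =O[𝓝 p₀]
        fun p => p.2 ^ (r + 3) := by
      have h2 := (isBigO_comp_sub_comp (contDiffAt_derivQ hl) hSt hDt).trans
        ((((isBigO_zero _ _).prod_left hsolW).prod_left (isBigO_zero _ _)).congr_left
          fun p => show ((((0 : E), _), (0 : ℝ)) : (E × E) × ℝ) = _ by
            simp [S, D, W, displacementMap])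
      simpa [pow_succ' _ (r + 2)] using
        (isBigO_refl (fun p : (E × E) × ℝ => p.2) (𝓝 p₀)).smul h2
    have h3 : (fun p => momentum L (Γ p) - momentum L (ϕ p)) =O[𝓝 p₀] fun p => p.2 ^ (r + 3) :=
      (isBigO_comp_sub_comp hx.momentum (hx.tendsto_taylorMap _) hϕ.tendsto).trans hΓϕ
    refine ((h1.add hW2).add h3).congr' ?_ EventuallyEq.rfl
    filter_upwards [hmt.eventually hUr] with p hp
    have h4 : derivW ℓ (S p) - p.2 • derivQ ℓ (S p) = momentum L p.1 := hp
    rw [← h4]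
    module

theorem integratorHasOrder {Q : Set E} (hQ : IsOpen Q)
    (hL : IsRegularLagrangian Q L) {r : ℕ} (hr : Odd (r + 1)) {m : ℕ} {b c : Fin m → ℝ}
    (hsymm : QuadratureSymmetric b c) (hord : QuadratureOrder b c (r + 2)) :
    IntegratorHasOrder Q L (discreteLagrangian L (r + 1) b c) (r + 2) := by
  intro K hK hKQ
  obtain ⟨ρ, hρ, C, hC, h₀, hh₀, h⟩ := exists_uniform_of_compact hK
    (R := fun ρ C p => ∃ y : E × (E →L[ℝ] ℝ),
      ‖p.2⁻¹ • (y.1 - p.1.1) - p.1.2‖ ≤ C * |p.2| ∧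
      IsStep (discreteLagrangian L (r + 1) b c) p.2 (p.1.1, momentum L p.1) y ∧
      (∀ y' : E × (E →L[ℝ] ℝ), ‖p.2⁻¹ • (y'.1 - p.1.1) - p.1.2‖ < ρ →
        IsStep (discreteLagrangian L (r + 1) b c) p.2 (p.1.1, momentum L p.1) y' → y' = y) ∧
      (∃ q v : ℝ → E, IsELSolution Q L (Set.uIcc 0 p.2) q v ∧ q 0 = p.1.1 ∧ v 0 = p.1.2) ∧
      ∀ q v : ℝ → E, IsELSolution Q L (Set.uIcc 0 p.2) q v → q 0 = p.1.1 → v 0 = p.1.2 →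
        ‖y.1 - q p.2‖ ≤ C * |p.2| ^ (r + 3) ∧
        ‖y.2 - momentum L (q p.2, v p.2)‖ ≤ C * |p.2| ^ (r + 3))
    (by
      rintro ρ ρ' C C' p hρ hC ⟨y, h1, h2, h3, h4, h5⟩
      refine ⟨y, h1.trans (by gcongr), h2, fun y' hy' => h3 y' (hy'.trans_le hρ), h4,
        fun q v hs hq hv => ?_⟩
      obtain ⟨h6, h7⟩ := h5 q v hs hq hv
      exact ⟨h6.trans (by gcongr), h7.trans (by gcongr)⟩)
    (fun x hxK => by
      have hx := hL.regularAt hQ (hKQ hxK).1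
      obtain ⟨V, hV⟩ := exists_isInverseVel hx r
      obtain ⟨ϕ, hϕ⟩ := exists_isLocalFlow hx.elField
      obtain ⟨sol, π, ρ, hρ, hstep, h1, h2, h3⟩ := exists_step hx hV hr hord hsymm hϕ
      obtain ⟨C₁, hC₁⟩ := h1.bound
      obtain ⟨C₂, hC₂⟩ := h2.bound
      obtain ⟨C₃, hC₃⟩ := h3.bound
      have hQx : ∀ᶠ y : E × E in 𝓝 x, y.1 ∈ Q :=
        (continuous_fst.tendsto x).eventually (hQ.mem_nhds (hKQ hxK).1)
      refine ⟨ρ, hρ, max C₁ (max C₂ C₃), ?_⟩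
      filter_upwards [hstep, hC₁, hC₂, hC₃,
        (continuous_fst.tendsto (x, (0 : ℝ))).eventually hϕ.initial,
        eventually_forall_uIcc ((hϕ.tendsto.eventually hQx).and hϕ.hasDerivAt) 0 1]
        with p hp e1 e2 e3 hp1 hflow hp0
      simp only [zero_mul, one_mul] at hflow
      obtain ⟨hs, hu⟩ := hp hp0
      have hquot : ∀ w : E, p.2⁻¹ • (p.1.1 + p.2 • w - p.1.1) = w := fun w => by
        rw [add_sub_cancel_left, smul_smul, inv_mul_cancel₀ hp0, one_smul]
      refine ⟨(p.1.1 + p.2 • sol p, π p), ?_, hs, ?_, ?_, ?_⟩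
      · rw [hquot]
        exact e1.trans (by rw [Real.norm_eq_abs]; gcongr; exact le_max_left _ _)
      · intro y' hy' hs'
        have hy1 : y'.1 = p.1.1 + p.2 • (p.2⁻¹ • (y'.1 - p.1.1)) := by
          rw [smul_smul, mul_inv_cancel₀ hp0, one_smul, add_sub_cancel]
        obtain ⟨hw, hy⟩ := hu _ y'.2 hy' (by rw [← hy1]; exact hs')
        exact Prod.ext (by rw [hy1, hw]) hy
      · refine ⟨_, _, isELSolution_of_hasDerivAt hQ hL (γ := fun t => ϕ (p.1, t))
          (fun t ht => (hflow t ht).1) (fun t ht => (hflow t ht).2), ?_, ?_⟩ <;> simp only [hp1]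
      · intro q v hsol hq hv
        have huniq : (q p.2, v p.2) = ϕ p := by
          have hud : UniqueDiffOn ℝ (Set.uIcc 0 p.2) :=
            uniqueDiffOn_Icc (by simpa using hp0)
          refine eq_of_hasDerivWithinAt (X := elField L) (γ₁ := fun t => (q t, v t))
            (γ₂ := fun t => ϕ (p.1, t)) (fun t ht => ?_) (fun t ht => ?_)
            (fun t ht => hsol.hasDerivWithinAt hQ hL ht (hud t ht))
            (fun t ht => (hflow t ht).2.hasDerivWithinAt) ?_
          · exact (hL.regularAt hQ (hsol.mem t ht)).elField
          · exact (hL.regularAt hQ (hflow t ht).1).elField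
          · simp [hp1, hq, hv]
        rw [huniq, show q p.2 = (ϕ p).1 from congrArg Prod.fst huniq]
        rw [norm_pow, Real.norm_eq_abs] at e2 e3
        exact ⟨e2.trans (by gcongr; exact le_max_of_le_right (le_max_left _ _)),
          e3.trans (by gcongr; exact le_max_of_le_right (le_max_right _ _))⟩)
  -- the bound `h₀ ≤ ρ / C` keeps the solution, at distance at most `C |h|`, in the `ρ`-ball
  refine ⟨ρ, hρ, min h₀ (ρ / C), lt_min hh₀ (div_pos hρ hC), C, fun τ hτ hτ' x hx => ?_⟩
  obtain ⟨y, h1, h2, h3, h4, h5⟩ := h x hx τ hτ (hτ'.trans_le (min_le_left _ _))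
  have hy : ‖τ⁻¹ • (y.1 - x.1) - x.2‖ < ρ := by
    refine h1.trans_lt ?_
    have := hτ'.trans_le (min_le_right _ _)
    rw [lt_div_iff₀ hC] at this
    linarith [mul_comm C |τ|]
  refine ⟨⟨y, ⟨hy, h2⟩, fun y' hy' => h3 y' hy'.1 hy'.2⟩, h4, fun y' hy' hs' => ?_⟩
  rw [h3 y' hy' hs']
  exact h5

end Order

end TaylorVI

end

theorem mainTheorem4 {E : Type*} [NormedAddCommGroup E] [NormedSpace ℝ E] [FiniteDimensional ℝ E]
    (Q : Set E) (hQ : IsOpen Q) (L : E × E → ℝ) (hL : TaylorVI.IsRegularLagrangian Q L)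
    (r : ℕ) (hr : Odd r) {m : ℕ} (b c : Fin m → ℝ)
    (hsymm : TaylorVI.QuadratureSymmetric b c)
    (hord : TaylorVI.QuadratureOrder b c (r + 1)) :
    TaylorVI.InverseWellPosed Q L r ∧
    TaylorVI.IntegratorHasOrder Q L (TaylorVI.discreteLagrangian L r b c) (r + 1) := by
  have : CompleteSpace E := FiniteDimensional.complete ℝ E
  obtain ⟨r, rfl⟩ : ∃ s, r = s + 1 := ⟨r - 1, by have := hr.pos; omega⟩
  exact ⟨TaylorVI.inverseWellPosed hQ hL r, TaylorVI.integratorHasOrder hQ hL hr hsymm hord⟩
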